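/- Let $\Sigma$ be a compact Riemann surface with (possibly empty) boundary $\partial\Sigma$, and let $(E,L)\to(\Sigma,\partial\Sigma)$ be a bundle pair: $E\to\Sigma$ is a smooth symplectic vector bundle with symplectic form $\omega$, and $L\to\partial\Sigma$ is a smooth Lagrangian subbundle of $E|_{\partial\Sigma}$. Let $J$ be a complex structure on $E$ compatible with $\omega$, let $g(v,w)=\omega(v,Jw)$, and regard $E$ as a complex vector bundle with hermitian inner product $g_{\mathbb C}=g+\sqrt{-1}\,\omega$. Connections on $E$ are smooth and complex linear ($\nabla J=0$); $F_\nabla\in\Omega^2(\Sigma,\mathrm{End}(E))$ denotes the curvature and $\mathrm{tr}$ the complex trace. A connection $\nabla$ is unitary if it is compatible with $g_{\mathbb C}$. A unitary connection is called $L$-orthogonal if its parallel transport along $\partial\Sigma$ preserves $L$. (1) If $\nabla^1,\nabla^2$ are $L$-orthogonal unitary connections on $E$, then $$\int_\Sigma \mathrm{tr}(F_{\nabla^1})=\int_\Sigma \mathrm{tr}(F_{\nabla^2}).$$ (2) More generally, the Chern--Weil Maslov index $$\mu_{CW}(E,L)=\frac{\sqrt{-1}}{\pi}\int_\Sigma \mathrm{tr}(F_\nabla)$$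 takes the same value for all connections $\nabla$ on $E$ that restrict, on $\partial\Sigma$, to an $L$-orthogonal unitary connection on $(E|_{\partial\Sigma},J)$ (that is, $\nabla$ is compatible with $g_{\mathbb C}$ in the directions tangent to $\partial\Sigma$, and its parallel transport along $\partial\Sigma$ preserves $L$). In this sense $\mu_{CW}(E,L)$, computed with the given $J$, does not depend on the choice of $\nabla$. -/

import Mathlib

open Bundle Set
open scoped Manifold ContDiff Topology

namespace MaslovCW

noncomputable section

/-! ### Riemann surfaces with boundary -/

/-- The standard complex structure `(x₀, x₁) ↦ (-x₁, x₀)` of `ℝ² = ℂ`, `z = x₀ + i x₁`. -/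
def rot (v : EuclideanSpace ℝ (Fin 2)) : EuclideanSpace ℝ (Fin 2) := !₂[-v 1, v 0]

/-- `M` is a *Riemann surface with boundary*: a smooth surface with boundary, modelled on the closed
half-plane `{Re z ≥ 0} ⊆ ℂ`, all of whose coordinate changes are holomorphic (up to the boundary),
i.e. their differentials commute with multiplication by `i`. -/
class IsRiemannSurface (M : Type*) [TopologicalSpace M]
    [ChartedSpace (EuclideanHalfSpace 2) M] : Prop extends IsManifold (𝓡∂ 2) ∞ M where
  holomorphic : ∀ e ∈ atlas (EuclideanHalfSpace 2) M, ∀ e' ∈ atlas (EuclideanHalfSpace 2) M,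
    ∀ p ∈ ((e.extend (𝓡∂ 2)).symm ≫ e'.extend (𝓡∂ 2)).source,
    ∀ v : EuclideanSpace ℝ (Fin 2),
      fderivWithin ℝ (e'.extend (𝓡∂ 2) ∘ (e.extend (𝓡∂ 2)).symm) (range (𝓡∂ 2)) p (rot v) =
        rot (fderivWithin ℝ (e'.extend (𝓡∂ 2) ∘ (e.extend (𝓡∂ 2)).symm) (range (𝓡∂ 2)) p v)

section Integral

variable {M : Type*} [TopologicalSpace M] [ChartedSpace (EuclideanHalfSpace 2) M]

/-- The tangent space to the boundary, for `x ∈ ∂M`: the tangent vectors at `x` whose component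
normal to the boundary of the half-plane vanishes (`TangentSpace (𝓡∂ 2) x` is `ℝ²`, through the
preferred chart at `x`). -/
def boundaryTangent (x : M) : Set (TangentSpace (𝓡∂ 2) x) :=
  {X | (show EuclideanSpace ℝ (Fin 2) from X) 0 = 0}

/-- The coordinate vector `∂/∂x_k`, of the preferred chart at `c`, at the point of coordinates `p`. -/
def coordVec (c : M) (p : EuclideanSpace ℝ (Fin 2)) (k : Fin 2) :
    TangentSpace (𝓡∂ 2) ((extChartAt (𝓡∂ 2) c).symm p) :=
  mfderivWithin 𝓘(ℝ, EuclideanSpace ℝ (Fin 2)) (𝓡∂ 2) (extChartAt (𝓡∂ 2) c).symm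
    (range (𝓡∂ 2)) p (EuclideanSpace.single k (1 : ℝ) : EuclideanSpace ℝ (Fin 2))

variable [T2Space M] [SigmaCompactSpace M]

/-- A partition of unity subordinate to the charts `(chartAt _ c)_c`. -/
def chartPartition [IsManifold (𝓡∂ 2) ∞ M] : SmoothPartitionOfUnity M (𝓡∂ 2) M univ :=
  (SmoothPartitionOfUnity.exists_isSubordinate_chartAt_source (𝓡∂ 2) M).choose

/-- The integral over an oriented surface (here oriented by its complex structure, so that all
charts are positively oriented) of a complex valued 2-form `α`:
`∫_M α = ∑_c ∫ ρ_c α(∂/∂x₀, ∂/∂x₁) dx₀ dx₁`. -/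
def surfaceIntegral [IsRiemannSurface M]
    (α : Π x : M, TangentSpace (𝓡∂ 2) x → TangentSpace (𝓡∂ 2) x → ℂ) : ℂ :=
  ∑ᶠ c : M, ∫ p in (extChartAt (𝓡∂ 2) c).target,
    (chartPartition (M := M) c ((extChartAt (𝓡∂ 2) c).symm p) : ℂ) *
      α ((extChartAt (𝓡∂ 2) c).symm p) (coordVec c p 0) (coordVec c p 1)

end Integral

/-- The complex trace of a complex linear endomorphism `T` of a real vector space with complex
structure `J`, expressed through real traces. -/
def complexTrace {W : Type*} [AddCommGroup W] [Module ℝ W] (J T : W →ₗ[ℝ] W) : ℂ :=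
  ((LinearMap.trace ℝ W T : ℂ) - Complex.I * (LinearMap.trace ℝ W (J ∘ₗ T) : ℂ)) / 2

/-- `complexTrace` is the usual trace over `ℂ`. -/
theorem complexTrace_restrictScalars {W : Type*} [AddCommGroup W] [Module ℝ W] [Module ℂ W]
    [IsScalarTower ℝ ℂ W] [FiniteDimensional ℂ W] (J : W →ₗ[ℝ] W)
    (hJ : ∀ w, J w = Complex.I • w) (T : W →ₗ[ℂ] W) :
    complexTrace J (T.restrictScalars ℝ) = LinearMap.trace ℂ W T := by
  have key : ∀ S : W →ₗ[ℂ] W, LinearMap.trace ℝ W (S.restrictScalars ℝ) =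
      2 * (LinearMap.trace ℂ W S).re := by
    intro S
    let b := Module.finBasis ℂ W
    rw [LinearMap.trace_eq_matrix_trace ℝ (Complex.basisOneI.smulTower b),
      LinearMap.trace_eq_matrix_trace ℂ b, Matrix.trace, Matrix.trace, Fintype.sum_prod_type,
      Fin.sum_univ_two, ← Finset.sum_add_distrib, Complex.re_sum, Finset.mul_sum]
    refine Finset.sum_congr rfl fun i _ ↦ ?_
    simp [LinearMap.toMatrix_apply, Module.Basis.smulTower_repr]
    ring
  have hJT : J ∘ₗ T.restrictScalars ℝ = (Complex.I • T).restrictScalars ℝ := by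
    ext w
    simp [hJ]
  rw [complexTrace, hJT, key, key]
  apply Complex.ext <;> simp

/-! ### Connections -/

section Connection

variable {M : Type*} [TopologicalSpace M] [ChartedSpace (EuclideanHalfSpace 2) M]
  [IsManifold (𝓡∂ 2) ∞ M]
  {F : Type*} [NormedAddCommGroup F] [NormedSpace ℝ F]
  {V : M → Type*} [TopologicalSpace (TotalSpace F V)]
  [∀ x, AddCommGroup (V x)] [∀ x, Module ℝ (V x)] [∀ x, TopologicalSpace (V x)]
  [∀ x, IsTopologicalAddGroup (V x)] [∀ x, ContinuousSMul ℝ (V x)]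
  [FiberBundle F V] [VectorBundle ℝ F V] [ContMDiffVectorBundle ∞ F V (𝓡∂ 2)]

/-- `∇_X ∇_Y σ - ∇_Y ∇_X σ - ∇_[X,Y] σ` at the point `x`. -/
def curvatureAux (cov : CovariantDerivative (𝓡∂ 2) F V) (X Y : Π x : M, TangentSpace (𝓡∂ 2) x)
    (σ : Π x : M, V x) (x : M) : V x :=
  cov (fun y ↦ cov σ y (Y y)) x (X x) - cov (fun y ↦ cov σ y (X y)) x (Y x)
    - cov σ x (VectorField.mlieBracket (𝓡∂ 2) X Y x)

variable [T2Space M] [FiniteDimensional ℝ F]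

theorem exists_smooth_extend (x : M) (σ₀ : V x) :
    ∃ σ : Π x, V x, ContMDiff (𝓡∂ 2) ((𝓡∂ 2).prod 𝓘(ℝ, F)) ∞ (T% σ) ∧
      ∀ᶠ y in 𝓝 x, σ y = FiberBundle.extend F σ₀ y := by
  obtain ⟨s, hs, hσ⟩ := FiberBundle.exists_contMDiffOn_extend (k := ∞) (𝓡∂ 2) F σ₀
  obtain ⟨u, hus, hu, hxu⟩ := mem_nhds_iff.mp hs
  obtain ⟨f, -, hf⟩ := (SmoothBumpFunction.nhds_basis_tsupport (I := 𝓡∂ 2) x).mem_iff.mp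
    (hu.mem_nhds hxu)
  refine ⟨(f : M → ℝ) • FiberBundle.extend F σ₀,
    ContMDiffOn.smul_section_of_tsupport f.contMDiff.contMDiffOn hu hf (hσ.mono hus), ?_⟩
  filter_upwards [f.eventuallyEq_one] with y hy
  simp [hy]

theorem extend_mdifferentiable_nhds (x : M) (σ₀ : V x) :
    ∀ᶠ y in 𝓝 x, MDifferentiableAt (𝓡∂ 2) ((𝓡∂ 2).prod 𝓘(ℝ, F))
      (T% (FiberBundle.extend F σ₀)) y := by
  obtain ⟨σ, hσ, heq⟩ := exists_smooth_extend (F := F) x σ₀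
  filter_upwards [heq.eventually_nhds] with y hy
  have : MDifferentiableAt (𝓡∂ 2) ((𝓡∂ 2).prod 𝓘(ℝ, F)) (T% σ) y :=
    (hσ y).mdifferentiableAt (by simp)
  exact this.congr_of_eventuallyEq (hy.mono fun z hz ↦ by simp [hz])

theorem mdifferentiableAt_cov_extend (cov : CovariantDerivative (𝓡∂ 2) F V)
    (hcov : CovariantDerivative.ContMDiffCovariantDerivative cov ∞) {x : M} (σ₀ : V x)
    {Y : Π x : M, TangentSpace (𝓡∂ 2) x}
    (hY : MDifferentiableAt (𝓡∂ 2) ((𝓡∂ 2).prod 𝓘(ℝ, EuclideanSpace ℝ (Fin 2))) (T% Y) x) :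
    MDifferentiableAt (𝓡∂ 2) ((𝓡∂ 2).prod 𝓘(ℝ, F))
      (T% (fun y ↦ cov (FiberBundle.extend F σ₀) y (Y y))) x := by
  obtain ⟨σ, hσ, heq⟩ := exists_smooth_extend (F := F) x σ₀
  have h1 := (hcov.contMDiff.contMDiff (σ := σ) (by simpa using hσ.contMDiffOn)).contMDiffAt
    (x := x) Filter.univ_mem
  have h2 := (h1.mdifferentiableAt (by simp)).clm_bundle_apply hY
  refine h2.congr_of_eventuallyEq ?_
  filter_upwards [heq.eventually_nhds, extend_mdifferentiable_nhds (F := F) x σ₀] with y hy h'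
  have : MDifferentiableAt (𝓡∂ 2) ((𝓡∂ 2).prod 𝓘(ℝ, F)) (T% σ) y :=
    (hσ y).mdifferentiableAt (by simp)
  simp [cov.isCovariantDerivativeOn.congr_of_eventuallyEq this h' Filter.univ_mem hy]

theorem extend_smul_add (x : M) (a : ℝ) (σ₀ τ₀ : V x) :
    ∀ᶠ y in 𝓝 x, FiberBundle.extend F (a • σ₀ + τ₀) y =
      (a • FiberBundle.extend F σ₀ + FiberBundle.extend F τ₀) y := by
  have hx := FiberBundle.mem_baseSet_trivializationAt' (F := F) (E := V) x
  have h := ((trivializationAt F V x).linear ℝ hx)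
  filter_upwards [(trivializationAt F V x).open_baseSet.mem_nhds hx] with y hy
  simp only [FiberBundle.extend, Pi.add_apply, Pi.smul_apply, h.map_add, h.map_smul,
    ← Trivialization.symmₗ_apply (R := ℝ) _ hy, map_add, map_smul]

theorem cov_smul_add (cov : CovariantDerivative (𝓡∂ 2) F V)
    {x : M} (a : ℝ) {σ τ : Π x : M, V x}
    (hσ : MDifferentiableAt (𝓡∂ 2) ((𝓡∂ 2).prod 𝓘(ℝ, F)) (T% σ) x)
    (hτ : MDifferentiableAt (𝓡∂ 2) ((𝓡∂ 2).prod 𝓘(ℝ, F)) (T% τ) x) :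
    cov (a • σ + τ) x = a • cov σ x + cov τ x := by
  rw [cov.isCovariantDerivativeOnUniv.add (hσ.smul_const_section) hτ,
    cov.isCovariantDerivativeOnUniv.smul_const a hσ]

theorem cov_cov_extend_smul_add (cov : CovariantDerivative (𝓡∂ 2) F V)
    (hcov : CovariantDerivative.ContMDiffCovariantDerivative cov ∞) {x : M} (a : ℝ) (σ₀ τ₀ : V x)
    {Y : Π x : M, TangentSpace (𝓡∂ 2) x}
    (hY : MDifferentiableAt (𝓡∂ 2) ((𝓡∂ 2).prod 𝓘(ℝ, EuclideanSpace ℝ (Fin 2))) (T% Y) x) :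
    cov (fun y ↦ cov (FiberBundle.extend F (a • σ₀ + τ₀)) y (Y y)) x =
      a • cov (fun y ↦ cov (FiberBundle.extend F σ₀) y (Y y)) x +
        cov (fun y ↦ cov (FiberBundle.extend F τ₀) y (Y y)) x := by
  have h1 := mdifferentiableAt_cov_extend cov hcov σ₀ hY
  have h2 := mdifferentiableAt_cov_extend cov hcov τ₀ hY
  have h3 := mdifferentiableAt_cov_extend cov hcov (a • σ₀ + τ₀) hY
  rw [← cov_smul_add cov a h1 h2]
  refine cov.isCovariantDerivativeOnUniv.congr_of_eventuallyEq h3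
    (mdifferentiableAt_add_section h1.smul_const_section h2) Filter.univ_mem ?_
  filter_upwards [extend_mdifferentiable_nhds (F := F) x σ₀,
    extend_mdifferentiable_nhds (F := F) x τ₀, extend_mdifferentiable_nhds (F := F) x (a • σ₀ + τ₀),
    (extend_smul_add (F := F) x a σ₀ τ₀).eventually_nhds] with y hy hy' hy'' he
  rw [cov.isCovariantDerivativeOnUniv.congr_of_eventuallyEq hy''
    (mdifferentiableAt_add_section hy.smul_const_section hy') Filter.univ_mem he,
    cov_smul_add cov a hy hy']
  simp

variable (F V) in
/-- A smooth connection `∇` on the vector bundle `V`; `cov σ x X` is `(∇_X σ)(x)`. -/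
structure SmoothConnection where
  cov : CovariantDerivative (𝓡∂ 2) F V
  smooth : CovariantDerivative.ContMDiffCovariantDerivative cov ∞

theorem SmoothConnection.curvatureAux_smul_add (D : SmoothConnection F V) (x : M)
    (X₀ Y₀ : TangentSpace (𝓡∂ 2) x) (a : ℝ) (σ₀ τ₀ : V x) :
    curvatureAux D.cov (FiberBundle.extend (EuclideanSpace ℝ (Fin 2)) X₀)
        (FiberBundle.extend (EuclideanSpace ℝ (Fin 2)) Y₀)
        (FiberBundle.extend F (a • σ₀ + τ₀)) x =
      a • curvatureAux D.cov (FiberBundle.extend (EuclideanSpace ℝ (Fin 2)) X₀)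
        (FiberBundle.extend (EuclideanSpace ℝ (Fin 2)) Y₀) (FiberBundle.extend F σ₀) x +
      curvatureAux D.cov (FiberBundle.extend (EuclideanSpace ℝ (Fin 2)) X₀)
        (FiberBundle.extend (EuclideanSpace ℝ (Fin 2)) Y₀) (FiberBundle.extend F τ₀) x := by
  have hext (Z : TangentSpace (𝓡∂ 2) x) := FiberBundle.mdifferentiableAt_extend (𝓡∂ 2)
    (EuclideanSpace ℝ (Fin 2)) (V := fun y : M ↦ TangentSpace (𝓡∂ 2) y) Z
  have hσ := FiberBundle.mdifferentiableAt_extend (𝓡∂ 2) F σ₀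
  have hτ := FiberBundle.mdifferentiableAt_extend (𝓡∂ 2) F τ₀
  unfold curvatureAux
  rw [cov_cov_extend_smul_add D.cov D.smooth a σ₀ τ₀ (hext X₀),
    cov_cov_extend_smul_add D.cov D.smooth a σ₀ τ₀ (hext Y₀),
    D.cov.isCovariantDerivativeOnUniv.congr_of_eventuallyEq
      (FiberBundle.mdifferentiableAt_extend (𝓡∂ 2) F (a • σ₀ + τ₀))
      (mdifferentiableAt_add_section hσ.smul_const_section hτ) Filter.univ_mem
      (extend_smul_add (F := F) x a σ₀ τ₀),
    cov_smul_add D.cov a hσ hτ]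
  simp only [add_apply, smul_apply]
  module

/-- The curvature `F_∇(X₀, Y₀) ∈ End (V x)`,
`F_∇(X, Y) σ = ∇_X ∇_Y σ - ∇_Y ∇_X σ - ∇_[X,Y] σ`,
where tangent vectors and elements of `V x` are extended to smooth local fields and sections
(being tensorial, the result does not depend on the extensions). -/
def SmoothConnection.curvature (D : SmoothConnection F V) (x : M) (X₀ Y₀ : TangentSpace (𝓡∂ 2) x) :
    V x →ₗ[ℝ] V x where
  toFun σ₀ := curvatureAux D.cov (FiberBundle.extend (EuclideanSpace ℝ (Fin 2)) X₀)
    (FiberBundle.extend (EuclideanSpace ℝ (Fin 2)) Y₀) (FiberBundle.extend F σ₀) x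
  map_add' σ₀ τ₀ := by simpa using D.curvatureAux_smul_add x X₀ Y₀ 1 σ₀ τ₀
  map_smul' a σ₀ := by
    have h0 := D.curvatureAux_smul_add x X₀ Y₀ 1 0 0
    have h := D.curvatureAux_smul_add x X₀ Y₀ a σ₀ 0
    simp only [smul_zero, add_zero, one_smul, left_eq_add] at h0
    simpa [h0] using h

/-- The section `s` along the curve `γ : [a, b] → M` is parallel for `∇`. If `c` denotes `s` in the
local trivialization of `V` at `γ t`, then `(∇_{γ'} s)(t)` is the sum of `c'(t)` and of `∇_{γ'(t)}`
of the local section that is constant, equal to `c(t)`, in this trivialization. -/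
def SmoothConnection.IsParallelAlong (D : SmoothConnection F V) (γ : ℝ → M) (a b : ℝ)
    (s : Π t : ℝ, V (γ t)) : Prop :=
  ∀ t ∈ Icc a b, ∃ c' : F,
    HasDerivWithinAt (fun u ↦ (trivializationAt F V (γ t) ⟨γ u, s u⟩).2) c' (Icc a b) t ∧
    (trivializationAt F V (γ t)).symm (γ t) c' +
      D.cov (FiberBundle.extend F (s t)) (γ t)
        (mfderivWithin 𝓘(ℝ, ℝ) (𝓡∂ 2) γ (Icc a b) t (1 : ℝ)) = 0

/-- Parallel transport along smooth curves contained in `∂M` maps the subspaces `L` into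
themselves. -/
def SmoothConnection.PreservesAlongBoundary (D : SmoothConnection F V)
    (L : Π x : M, Submodule ℝ (V x)) : Prop :=
  ∀ (γ : ℝ → M) (a b : ℝ), a < b → ContMDiffOn 𝓘(ℝ, ℝ) (𝓡∂ 2) ∞ γ (Icc a b) →
    (∀ t ∈ Icc a b, γ t ∈ (𝓡∂ 2).boundary M) →
    ∀ s : Π t : ℝ, V (γ t), D.IsParallelAlong γ a b s → s a ∈ L (γ a) → s b ∈ L (γ b)

/-! ### Bundle pairs -/

variable (F V) in
/-- A *bundle pair* `(E, L) → (M, ∂M)`: a symplectic form on the smooth real vector bundle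
`E = V`, and a smooth Lagrangian subbundle `L` of `V` over `∂M`. (Only the values of `L` at points
of `∂M` are meaningful.) -/
structure BundlePair where
  form : Π x : M, V x →L[ℝ] V x →L[ℝ] ℝ
  form_smooth : ContMDiff (𝓡∂ 2) ((𝓡∂ 2).prod 𝓘(ℝ, F →L[ℝ] F →L[ℝ] ℝ)) ∞
    (fun x ↦ TotalSpace.mk' (F →L[ℝ] F →L[ℝ] ℝ) x (form x))
  form_alternating : ∀ x v, form x v v = 0
  form_nondegenerate : ∀ x v, (∀ w, form x v w = 0) → v = 0
  L : Π x : M, Submodule ℝ (V x)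
  L_smooth : ∀ x ∈ (𝓡∂ 2).boundary M, ∃ U ∈ 𝓝 x, ∃ (n : ℕ) (e : Fin n → Π y : M, V y),
    (∀ i, ContMDiffOn (𝓡∂ 2) ((𝓡∂ 2).prod 𝓘(ℝ, F)) ∞ (T% (e i)) U) ∧
    ∀ y ∈ U ∩ (𝓡∂ 2).boundary M, LinearIndependent ℝ (fun i ↦ e i y) ∧
      Submodule.span ℝ (range fun i ↦ e i y) = L y
  L_lagrangian : ∀ x ∈ (𝓡∂ 2).boundary M, ∀ v, v ∈ L x ↔ ∀ w ∈ L x, form x v w = 0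

/-- A complex structure `J` on `V` compatible with the symplectic form. -/
structure CompatibleComplexStructure (P : BundlePair F V) where
  J : Π x : M, V x →L[ℝ] V x
  J_smooth : ContMDiff (𝓡∂ 2) ((𝓡∂ 2).prod 𝓘(ℝ, F →L[ℝ] F)) ∞
    (fun x ↦ TotalSpace.mk' (F →L[ℝ] F) x (J x))
  J_sq : ∀ x v, J x (J x v) = -v
  invariant : ∀ x v w, P.form x (J x v) (J x w) = P.form x v w
  pos : ∀ x v, v ≠ 0 → 0 < P.form x v (J x v)

variable {P : BundlePair F V}

namespace CompatibleComplexStructure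

/-- The hermitian inner product `g + i ω`, where `g(v, w) = ω(v, J w)`. -/
def hermitian (𝒥 : CompatibleComplexStructure P) (x : M) (v w : V x) : ℂ :=
  (P.form x v (𝒥.J x w) : ℂ) + Complex.I * (P.form x v w : ℂ)

/-- A smooth connection on the complex vector bundle `(V, J)`: `∇ (J σ) = J ∇ σ`. -/
structure Connection (𝒥 : CompatibleComplexStructure P) extends SmoothConnection F V where
  complex_linear : ∀ (σ : Π x : M, V x) (x : M) (X : TangentSpace (𝓡∂ 2) x),
    MDifferentiableAt (𝓡∂ 2) ((𝓡∂ 2).prod 𝓘(ℝ, F)) (T% σ) x →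
      cov (fun y ↦ 𝒥.J y (σ y)) x X = 𝒥.J x (cov σ x X)

variable {𝒥 : CompatibleComplexStructure P}

namespace Connection

/-- `∇` is compatible with the hermitian metric in the direction of the tangent vector `X`:
`X ⟨σ, τ⟩ = ⟨∇_X σ, τ⟩ + ⟨σ, ∇_X τ⟩`. -/
def IsUnitaryInDirection (D : 𝒥.Connection) (x : M) (X : TangentSpace (𝓡∂ 2) x) : Prop :=
  ∀ σ τ : Π x : M, V x,
    MDifferentiableAt (𝓡∂ 2) ((𝓡∂ 2).prod 𝓘(ℝ, F)) (T% σ) x →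
    MDifferentiableAt (𝓡∂ 2) ((𝓡∂ 2).prod 𝓘(ℝ, F)) (T% τ) x →
    mvfderiv (𝓡∂ 2) (fun y ↦ 𝒥.hermitian y (σ y) (τ y)) x X =
      𝒥.hermitian x (D.cov σ x X) (τ x) + 𝒥.hermitian x (σ x) (D.cov τ x X)

/-- `∇` is an `L`-orthogonal unitary connection on `V → M`. -/
def IsLOrthogonalUnitary (D : 𝒥.Connection) : Prop :=
  (∀ x X, D.IsUnitaryInDirection x X) ∧ D.PreservesAlongBoundary P.L

/-- `∇` restricts, on `∂M`, to an `L`-orthogonal unitary connection on `V|_{∂M}`. -/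
def RestrictsToLOrthogonalUnitary (D : 𝒥.Connection) : Prop :=
  (∀ x ∈ (𝓡∂ 2).boundary M, ∀ X ∈ boundaryTangent x, D.IsUnitaryInDirection x X) ∧
    D.PreservesAlongBoundary P.L

/-- The 2-form `tr F_∇` (trace over `ℂ`). -/
def trCurvature (D : 𝒥.Connection) (x : M) (X Y : TangentSpace (𝓡∂ 2) x) : ℂ :=
  complexTrace (𝒥.J x : V x →ₗ[ℝ] V x) (D.curvature x X Y)

end Connection

end CompatibleComplexStructure

end Connection

end

end MaslovCW

/-!
Two connections differ by an `End E`-valued 1-form `A = ∇¹ - ∇²`, and locally the curvatures differ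
by `dA` plus brackets, whose traces vanish, so that `tr F₁ - tr F₂ = d (tr A)`. By Stokes' theorem
it is enough that `tr A(X) = 0` for `X` tangent to `∂Σ`. There `A(X)` is skew-Hermitian because both
connections are unitary along `∂Σ`, which makes its trace imaginary; and `A(X)` preserves `L`, as
one sees by differentiating at `t = 0` the difference of the two parallel transports of a vector of
`L` along the boundary. Hence `tr A(X)` is the trace of a real endomorphism of `L`, thus real, and
so zero.

The surface integral is defined through a partition of unity subordinate to charts, so Stokes'
theorem reduces to compactly supported 1-forms on the half-plane, once the integral of a form
supported in two charts is known not to depend on the chart.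
-/

open MeasureTheory

namespace MaslovCW

noncomputable section

section ExtensionByZero

theorem tsupport_indicator_subset_of_isClosed {X A : Type*} [TopologicalSpace X]
    [Zero A] {s K : Set X} (hK : IsClosed K) {f : X → A} (hf : ∀ p ∈ s \ K, f p = 0) :
    tsupport (s.indicator f) ⊆ K := by
  refine closure_minimal (fun p hp ↦ ?_) hK
  rw [Function.mem_support, indicator_apply_ne_zero] at hp
  by_contra hpK
  exact hp.2 (hf p ⟨hp.1, hpK⟩)

variable {E E' : Type*} [NormedAddCommGroup E] [NormedSpace ℝ E] [NormedAddCommGroup E']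
  [NormedSpace ℝ E']

theorem fderivWithin_eq_zero_of_notMem_tsupport {f : E' → E} {s : Set E'} {p : E'}
    (hp : p ∉ tsupport f) : fderivWithin ℝ f s p = 0 := by
  have hf : f =ᶠ[𝓝 p] fun _ ↦ 0 := notMem_tsupport_iff_eventuallyEq.1 hp
  rw [(hf.filter_mono nhdsWithin_le_nhds).fderivWithin_eq hf.eq_of_nhds]
  simp

theorem contDiffOn_indicator_of_isClosed {m : ℕ∞ω} {s t K : Set E'}
    (hs : ∀ p ∈ s, s ∈ 𝓝[t] p) (hK : IsClosed K) (hKs : K ⊆ s) {f : E' → E}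
    (hf : ContDiffOn ℝ m f s) (hfK : ∀ p ∈ s \ K, f p = 0) : ContDiffOn ℝ m (s.indicator f) t := by
  intro p _
  by_cases hps : p ∈ s
  · refine ((hf p hps).mono_of_mem_nhdsWithin (hs p hps)).congr_of_eventuallyEq ?_
      (indicator_of_mem hps f)
    filter_upwards [hs p hps] with q hq using indicator_of_mem hq f
  · have hp : p ∉ tsupport (s.indicator f) := fun h ↦
      hps (hKs (tsupport_indicator_subset_of_isClosed hK hfK h))
    have hzero : s.indicator f =ᶠ[𝓝 p] fun _ ↦ 0 := notMem_tsupport_iff_eventuallyEq.1 hp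
    exact contDiffWithinAt_const.congr_of_eventuallyEq (hzero.filter_mono nhdsWithin_le_nhds)
      hzero.eq_of_nhds

end ExtensionByZero

section HalfSpace

variable {n : ℕ} {E : Type*} [NormedAddCommGroup E] [NormedSpace ℝ E]

theorem mem_range_halfSpace {p : EuclideanSpace ℝ (Fin (n + 1))} :
    p ∈ range (𝓡∂ (n + 1)) ↔ 0 ≤ p 0 := by
  rw [range_modelWithCornersEuclideanHalfSpace]
  rfl

theorem range_halfSpace_mem_nhds {p : EuclideanSpace ℝ (Fin (n + 1))} (hp : 0 < p 0) :
    range (𝓡∂ (n + 1)) ∈ 𝓝 p := by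
  have hopen : IsOpen {q : EuclideanSpace ℝ (Fin (n + 1)) | 0 < q 0} :=
    isOpen_lt continuous_const (by fun_prop)
  exact Filter.mem_of_superset (hopen.mem_nhds hp) fun q hq ↦ mem_range_halfSpace.2 (le_of_lt hq)

variable (n) in
/-- The half-cube `[0, S] × [-S, S]ⁿ`, for integration on a half-space. -/
def halfCube (S : ℝ) : Set (Fin (n + 1) → ℝ) :=
  Icc (Fin.cons 0 fun _ ↦ -S) fun _ ↦ S

theorem mem_halfCube {S : ℝ} {x : Fin (n + 1) → ℝ} :
    x ∈ halfCube n S ↔ 0 ≤ x 0 ∧ ∀ i, |x i| ≤ S := by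
  simp only [halfCube, mem_Icc, Pi.le_def, Fin.forall_fin_succ, Fin.cons_zero, Fin.cons_succ,
    abs_le, forall_and]
  constructor
  · rintro ⟨⟨h0, h⟩, h0', h'⟩
    exact ⟨h0, ⟨by linarith, h⟩, h0', h'⟩
  · rintro ⟨h0, ⟨-, h⟩, h0', h'⟩
    exact ⟨⟨h0, h⟩, h0', h'⟩

/-- The divergence of the vector field with components `G i` on the half-space. -/
def halfSpaceDivergence (G : Fin (n + 1) → EuclideanSpace ℝ (Fin (n + 1)) → E)
    (p : EuclideanSpace ℝ (Fin (n + 1))) : E :=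
  ∑ i, fderivWithin ℝ (G i) (range (𝓡∂ (n + 1))) p (EuclideanSpace.single i 1)

variable {G : Fin (n + 1) → EuclideanSpace ℝ (Fin (n + 1)) → E}

theorem continuousOn_halfSpaceDivergence
    (hG : ∀ i, ContDiffOn ℝ 1 (G i) (range (𝓡∂ (n + 1)))) :
    ContinuousOn (halfSpaceDivergence G) (range (𝓡∂ (n + 1))) :=
  continuousOn_finsetSum _ fun i _ ↦
    ((hG i).continuousOn_fderivWithin (𝓡∂ (n + 1)).uniqueDiffOn le_rfl).clm_apply
      continuousOn_const

theorem integral_halfCube_divergence_eq_zero [CompleteSpace E] {S : ℝ} (hS : 0 ≤ S)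
    (hG : ∀ i, ContDiffOn ℝ 1 (G i) (range (𝓡∂ (n + 1))))
    (hGS : ∀ i p, |p i| = S → G i p = 0) (hG₀ : ∀ p, p 0 = 0 → G 0 p = 0) :
    ∫ x in halfCube n S, halfSpaceDivergence G (WithLp.toLp 2 x) = 0 := by
  set e := (EuclideanSpace.equiv (Fin (n + 1)) ℝ).symm
  have he : MapsTo e (halfCube n S) (range (𝓡∂ (n + 1))) := fun x hx ↦
    mem_range_halfSpace.2 (mem_halfCube.1 hx).1
  have hle : (Fin.cons 0 fun _ ↦ -S : Fin (n + 1) → ℝ) ≤ fun _ ↦ S := by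
    refine fun i ↦ Fin.cases hS (fun j ↦ ?_) i
    exact (neg_nonpos.2 hS).trans hS
  have hderiv : ∀ x ∈ pi univ fun i ↦ Ioo ((Fin.cons 0 fun _ ↦ -S : Fin (n + 1) → ℝ) i) S,
      ∀ i, HasFDerivAt (G i ∘ e) (fderivWithin ℝ (G i) (range (𝓡∂ (n + 1))) (e x) ∘L e) x := by
    intro x hx i
    have hmem : range (𝓡∂ (n + 1)) ∈ 𝓝 (e x) := range_halfSpace_mem_nhds (hx 0 trivial).1
    have hdiff := (hG i).differentiableOn one_ne_zero _ (mem_of_mem_nhds hmem)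
    exact (hdiff.hasFDerivWithinAt.hasFDerivAt hmem).comp x e.hasFDerivAt
  have hface : ∀ i t, (t = S ∨ t = (Fin.cons 0 fun _ ↦ -S : Fin (n + 1) → ℝ) i) →
      ∀ y, G i (e (i.insertNth t y)) = 0 := by
    intro i t ht y
    have hval : e (i.insertNth t y) i = t := by simp [e]
    rcases ht with rfl | rfl
    · exact hGS i _ (by rw [hval, abs_of_nonneg hS])
    · cases i using Fin.cases with
      | zero => exact hG₀ _ hval
      | succ j => exact hGS _ _ (by rw [hval, Fin.cons_succ, abs_neg, abs_of_nonneg hS])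
  have hdiv : ∀ x, halfSpaceDivergence G (e x) =
      ∑ i, (fderivWithin ℝ (G i) (range (𝓡∂ (n + 1))) (e x) ∘L e.toContinuousLinearMap)
        (Pi.single i 1) :=
    fun x ↦ rfl
  have hint : IntegrableOn (fun x ↦ halfSpaceDivergence G (e x)) (halfCube n S) :=
    ((continuousOn_halfSpaceDivergence hG).comp e.continuous.continuousOn he).integrableOn_compact
      isCompact_Icc
  simp only [hdiv] at hint
  refine (integral_divergence_of_hasFDerivAt_off_countable' _ _ hle (fun i ↦ G i ∘ e) _ ∅
    countable_empty (fun i ↦ (hG i).continuousOn.comp e.continuous.continuousOn he)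
    (fun x hx ↦ hderiv x hx.1) hint).trans (Finset.sum_eq_zero fun i _ ↦ ?_)
  simp only [Function.comp_apply, hface i _ (.inl rfl), hface i _ (.inr rfl), integral_zero,
    sub_zero]

theorem integral_halfSpaceDivergence_eq_zero [CompleteSpace E]
    (hG : ∀ i, ContDiffOn ℝ 1 (G i) (range (𝓡∂ (n + 1))))
    (hGc : ∀ i, HasCompactSupport (G i)) (hG₀ : ∀ p, p 0 = 0 → G 0 p = 0) :
    ∫ p in range (𝓡∂ (n + 1)), halfSpaceDivergence G p = 0 := by
  obtain ⟨S, hS0, hS⟩ : ∃ S > 0, (⋃ i, tsupport (G i)) ⊆ Metric.ball 0 S :=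
    (isCompact_iUnion hGc).isBounded.subset_ball_lt 0 0
  have hout : ∀ p : EuclideanSpace ℝ (Fin (n + 1)), ∀ j, S ≤ |p j| → ∀ i, p ∉ tsupport (G i) := by
    intro p j hj i hp
    have hpS : ‖p‖ < S := mem_ball_zero_iff.1 (hS (mem_iUnion_of_mem i hp))
    exact (hj.trans (PiLp.norm_apply_le p j)).not_gt hpS
  have hcube : (WithLp.ofLp ⁻¹' halfCube n S) ⊆ range (𝓡∂ (n + 1)) := fun p hp ↦
    mem_range_halfSpace.2 (mem_halfCube.1 hp).1
  rw [setIntegral_eq_of_subset_of_forall_sdiff_eq_zero (𝓡∂ (n + 1)).isClosed_range.measurableSet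
    hcube]
  · refine Eq.trans ?_ (integral_halfCube_divergence_eq_zero hS0.le hG (fun i p hp ↦
      image_eq_zero_of_notMem_tsupport (hout p i hp.ge i)) hG₀)
    exact (PiLp.volume_preserving_ofLp _).setIntegral_preimage_emb
      (MeasurableEquiv.toLp 2 _).symm.measurableEmbedding
      (fun x ↦ halfSpaceDivergence G (WithLp.toLp 2 x)) _
  · rintro p ⟨hp, hpS⟩
    obtain ⟨j, hj⟩ : ∃ j, S < |p j| := by
      simpa [mem_halfCube, mem_range_halfSpace.1 hp] using hpS
    exact Finset.sum_eq_zero fun i _ ↦ by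
      rw [fderivWithin_eq_zero_of_notMem_tsupport (hout p j hj.le i), zero_apply]

theorem integral_halfSpaceDivergence_eq_zero_of_support_subset [CompleteSpace E]
    {T K : Set (EuclideanSpace ℝ (Fin (n + 1)))} (hTm : MeasurableSet T)
    (hTH : T ⊆ range (𝓡∂ (n + 1))) (hT : ∀ p ∈ T, T ∈ 𝓝[range (𝓡∂ (n + 1))] p) (hK : IsCompact K)
    (hKT : K ⊆ T) (hG : ∀ i, ContDiffOn ℝ 1 (G i) T) (hGK : ∀ i, ∀ p ∈ T \ K, G i p = 0)
    (hG₀ : ∀ p ∈ T, p 0 = 0 → G 0 p = 0) :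
    ∫ p in T, halfSpaceDivergence G p = 0 := by
  have hsupp : ∀ i, tsupport (T.indicator (G i)) ⊆ K := fun i ↦
    tsupport_indicator_subset_of_isClosed hK.isClosed (hGK i)
  have hT₀ : ∀ p, p 0 = 0 → T.indicator (G 0) p = 0 := fun p hp ↦
    indicator_apply_eq_zero.2 fun hpT ↦ hG₀ p hpT hp
  rw [← integral_halfSpaceDivergence_eq_zero
    (fun i ↦ contDiffOn_indicator_of_isClosed hT hK.isClosed hKT (hG i) (hGK i))
    (fun i ↦ hK.of_isClosed_subset (isClosed_tsupport _) (hsupp i)) hT₀,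
    setIntegral_eq_of_subset_of_forall_sdiff_eq_zero
      (𝓡∂ (n + 1)).isClosed_range.measurableSet hTH]
  · refine setIntegral_congr_fun hTm fun p hp ↦ Finset.sum_congr rfl fun i _ ↦ ?_
    have hind : T.indicator (G i) =ᶠ[𝓝[range (𝓡∂ (n + 1))] p] G i := by
      filter_upwards [hT p hp] with q hq using indicator_of_mem hq _
    rw [hind.fderivWithin_eq (indicator_of_mem hp _)]
  · rintro p ⟨-, hpT⟩
    exact Finset.sum_eq_zero fun i _ ↦ by
      rw [fderivWithin_eq_zero_of_notMem_tsupport fun h ↦ hpT (hKT (hsupp i h)), zero_apply]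

end HalfSpace

section CoordinateFields

variable {E : Type*} [NormedAddCommGroup E] [NormedSpace ℝ E] {H : Type*} [TopologicalSpace H]
  {I : ModelWithCorners ℝ E H} {M : Type*} [TopologicalSpace M] [ChartedSpace H M]

theorem contMDiffOn_symmL {F : Type*} [NormedAddCommGroup F] [NormedSpace ℝ F] {V : M → Type*}
    [TopologicalSpace (TotalSpace F V)] [∀ x, AddCommGroup (V x)] [∀ x, Module ℝ (V x)]
    [∀ x, TopologicalSpace (V x)] [FiberBundle F V] [VectorBundle ℝ F V] {n : ℕ∞ω}
    [ContMDiffVectorBundle n F V I] (e : Trivialization F (TotalSpace.proj : TotalSpace F V → M))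
    [MemTrivializationAtlas e] (v : F) :
    ContMDiffOn I (I.prod 𝓘(ℝ, F)) n (T% fun y ↦ e.symmL ℝ y v) e.baseSet := by
  intro x hx
  rw [e.contMDiffWithinAt_section _ hx]
  exact (contMDiffWithinAt_const (c := v)).congr (fun y hy ↦ by simp [hy]) (by simp [hx])

variable [IsManifold I ∞ M]

variable (I) in
/-- The vector field with constant coordinates `v` in the preferred chart at `c`
(it vanishes outside of the domain of this chart). -/
def coordField (c : M) (v : E) (y : M) : TangentSpace I y :=
  (trivializationAt E (TangentSpace I) c).symmL ℝ y v

variable {c y : M} {v w : E}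

theorem contMDiffAt_coordField (v : E) (hy : y ∈ (extChartAt I c).source) :
    ContMDiffAt I (I.prod 𝓘(ℝ, E)) ∞ (T% (coordField I c v)) y := by
  rw [extChartAt_source] at hy
  exact (contMDiffOn_symmL (trivializationAt E (TangentSpace I) c) v).contMDiffAt
    ((chartAt H c).open_source.mem_nhds hy)

theorem coordField_eq_mfderivWithin (hy : y ∈ (extChartAt I c).source) :
    coordField I c v y = mfderivWithin 𝓘(ℝ, E) I (extChartAt I c).symm (range I)
      (extChartAt I c y) v := by
  rw [extChartAt_source] at hy
  rw [coordField, TangentBundle.symmL_trivializationAt hy]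
  rfl

theorem coordVec_eq_coordField {M : Type*} [TopologicalSpace M]
    [ChartedSpace (EuclideanHalfSpace 2) M] [IsManifold (𝓡∂ 2) ∞ M] {c : M}
    {p : EuclideanSpace ℝ (Fin 2)} (hp : p ∈ (extChartAt (𝓡∂ 2) c).target) (k : Fin 2) :
    coordVec c p k =
      coordField (𝓡∂ 2) c (EuclideanSpace.single k 1) ((extChartAt (𝓡∂ 2) c).symm p) := by
  rw [coordField_eq_mfderivWithin ((extChartAt (𝓡∂ 2) c).map_target hp), coordVec,
    (extChartAt (𝓡∂ 2) c).right_inv hp]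

theorem coordField_mfderiv_extChartAt (hy : y ∈ (extChartAt I c).source)
    (X : TangentSpace I y) :
    coordField I c (mfderiv I 𝓘(ℝ, E) (extChartAt I c) y X) y = X := by
  rw [extChartAt_source] at hy
  rw [← TangentBundle.continuousLinearMapAt_trivializationAt hy]
  exact (trivializationAt E (TangentSpace I) c).symmL_continuousLinearMapAt (by simpa using hy) X

theorem mfderiv_extChartAt_coordField (hy : y ∈ (extChartAt I c).source) :
    mfderiv I 𝓘(ℝ, E) (extChartAt I c) y (coordField I c v y) = v := by
  rw [extChartAt_source] at hy
  rw [← TangentBundle.continuousLinearMapAt_trivializationAt hy]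
  exact (trivializationAt E (TangentSpace I) c).continuousLinearMapAt_symmL (by simpa using hy) v

theorem mvfderiv_coordField {G : Type*} [NormedAddCommGroup G] [NormedSpace ℝ G]
    (hy : y ∈ (extChartAt I c).source) {f : M → G} (hf : MDifferentiableAt I 𝓘(ℝ, G) f y) :
    mvfderiv I f y (coordField I c v y) =
      fderivWithin ℝ (f ∘ (extChartAt I c).symm) (range I) (extChartAt I c y) v := by
  have hp := (extChartAt I c).map_source hy
  rw [← mfderivWithin_eq_fderivWithin, mfderiv_comp_mfderivWithin_of_eq (I' := I) hf
    (mdifferentiableWithinAt_extChartAt_symm hp)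
    (I.uniqueMDiffOn _ (extChartAt_target_subset_range c hp)) ((extChartAt I c).left_inv hy),
    coordField_eq_mfderivWithin hy]
  rfl

theorem coordField_eq_coordField_fderivWithin {c' : M} (hy : y ∈ (extChartAt I c).source)
    (hy' : y ∈ (extChartAt I c').source) :
    coordField I c v y = coordField I c' (fderivWithin ℝ (extChartAt I c' ∘ (extChartAt I c).symm)
      (range I) (extChartAt I c y) v) y := by
  rw [← mvfderiv_coordField hy (mdifferentiableAt_extChartAt (by simpa using hy'))]
  exact (coordField_mfderiv_extChartAt hy' _).symm

variable (v) in
/-- The constant vector field on a vector space. -/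
def constField (p : E) : TangentSpace 𝓘(ℝ, E) p := v

theorem mdifferentiableAt_constField (p : E) :
    MDifferentiableAt 𝓘(ℝ, E) (𝓘(ℝ, E).prod 𝓘(ℝ, E)) (T% (constField v)) p :=
  ContMDiffAt.mdifferentiableAt (n := 1)
    (contMDiffAt_vectorSpace_iff_contDiffAt.2 (contDiffAt_const (c := v))) (by simp)

theorem mlieBracket_constField :
    VectorField.mlieBracket 𝓘(ℝ, E) (constField v) (constField w) = 0 := by
  have h : VectorField.lieBracketWithin ℝ (fun _ : E ↦ v) (fun _ ↦ w) univ = 0 :=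
    funext fun _ ↦ by simp [VectorField.lieBracketWithin]
  rw [← VectorField.mlieBracketWithin_univ, VectorField.mlieBracketWithin_eq_lieBracketWithin]
  exact h

theorem mpullback_constField [CompleteSpace E] (hy : y ∈ (extChartAt I c).source) :
    VectorField.mpullback I 𝓘(ℝ, E) (extChartAt I c) (constField v) y = coordField I c v y := by
  have h := mfderiv_extChartAt_coordField (v := v) hy
  obtain ⟨e, he⟩ := isInvertible_mfderiv_extChartAt (I := I) hy
  rw [VectorField.mpullback_apply, ← he, ContinuousLinearMap.inverse_equiv]
  rw [← he] at h
  exact e.symm_apply_eq.2 h.symm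

theorem mlieBracket_coordField [CompleteSpace E] (hy : y ∈ (extChartAt I c).source) :
    VectorField.mlieBracket I (coordField I c v) (coordField I c w) y = 0 := by
  have hpull : ∀ u, coordField I c u =ᶠ[𝓝 y]
      VectorField.mpullback I 𝓘(ℝ, E) (extChartAt I c) (constField u) := fun u ↦ by
    filter_upwards [(isOpen_extChartAt_source c).mem_nhds hy] with z hz
    exact (mpullback_constField hz).symm
  have : IsManifold I (minSmoothness ℝ 2) M := by
    rw [minSmoothness_of_isRCLikeNormedField]; infer_instance
  rw [(hpull v).mlieBracket_vectorField_eq (hpull w),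
    ← VectorField.mpullback_mlieBracket (n := ∞) (mdifferentiableAt_constField _)
      (mdifferentiableAt_constField _) (contMDiffAt_extChartAt' (by simpa using hy))
      (by simpa using ENat.LEInfty.out), mlieBracket_constField]
  simp

end CoordinateFields

section CoordinateDerivatives

variable {E : Type*} [NormedAddCommGroup E] [NormedSpace ℝ E] {H : Type*} [TopologicalSpace H]
  {I : ModelWithCorners ℝ E H} {M : Type*} [TopologicalSpace M] [ChartedSpace H M]
  {G G' G'' : Type*} [NormedAddCommGroup G] [NormedSpace ℝ G] [NormedAddCommGroup G']
  [NormedSpace ℝ G'] [NormedAddCommGroup G''] [NormedSpace ℝ G''] {c y : M} {v w : E}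

theorem mvfderiv_congr {f g : M → G} (h : f =ᶠ[𝓝 y] g) : mvfderiv I f y = mvfderiv I g y := by
  rw [mvfderiv, mvfderiv, h.mfderiv_eq, h.eq_of_nhds]

theorem mdifferentiableAt_finset_sum {ι : Type*} (s : Finset ι) {f : ι → M → G}
    (hf : ∀ i ∈ s, MDifferentiableAt I 𝓘(ℝ, G) (f i) y) :
    MDifferentiableAt I 𝓘(ℝ, G) (fun z ↦ ∑ i ∈ s, f i z) y := by
  classical
  induction s using Finset.induction_on with
  | empty => simpa using mdifferentiableAt_const
  | insert i s hi ih =>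
    simp only [Finset.sum_insert hi]
    exact (hf i (s.mem_insert_self i)).add (ih fun j hj ↦ hf j (s.mem_insert_of_mem hj))

theorem mvfderiv_finset_sum {ι : Type*} (s : Finset ι) {f : ι → M → G}
    (hf : ∀ i ∈ s, MDifferentiableAt I 𝓘(ℝ, G) (f i) y) :
    mvfderiv I (fun z ↦ ∑ i ∈ s, f i z) y = ∑ i ∈ s, mvfderiv I (f i) y := by
  classical
  induction s using Finset.induction_on with
  | empty => simpa using mvfderiv_const (0 : G)
  | insert i s hi ih =>
    have hs : ∀ j ∈ s, MDifferentiableAt I 𝓘(ℝ, G) (f j) y :=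
      fun j hj ↦ hf j (s.mem_insert_of_mem hj)
    simp only [Finset.sum_insert hi]
    rw [mvfderiv_fun_add (hf i (s.mem_insert_self i)) (mdifferentiableAt_finset_sum s hs), ih hs]

theorem mvfderiv_eq_zero_of_notMem_tsupport {f : M → G} (hy : y ∉ tsupport f) :
    mvfderiv I f y = 0 := by
  rw [mvfderiv_congr (notMem_tsupport_iff_eventuallyEq.1 hy)]
  exact mvfderiv_zero

variable [IsManifold I ∞ M]

theorem differentiableWithinAt_comp_extChartAt_symm (hy : y ∈ (extChartAt I c).source)
    {f : M → G} (hf : MDifferentiableAt I 𝓘(ℝ, G) f y) :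
    DifferentiableWithinAt ℝ (f ∘ (extChartAt I c).symm) (range I) (extChartAt I c y) :=
  have : IsManifold I 1 M := .of_le (n := ∞) (by simp)
  ((mdifferentiableAt_iff_source_of_mem_source (by simpa using hy)).1 hf).differentiableWithinAt

theorem contMDiffAt_iff_contDiffWithinAt_comp_extChartAt_symm
    (hy : y ∈ (extChartAt I c).source) {f : M → G} :
    ContMDiffAt I 𝓘(ℝ, G) ∞ f y ↔
      ContDiffWithinAt ℝ ∞ (f ∘ (extChartAt I c).symm) (range I) (extChartAt I c y) := by
  rw [contMDiffAt_iff_source_of_mem_source (by simpa using hy),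
    contMDiffWithinAt_iff_contDiffWithinAt]

theorem mvfderiv_bilinear (B : G →L[ℝ] G' →L[ℝ] G'') {f : M → G} {g : M → G'}
    (hf : MDifferentiableAt I 𝓘(ℝ, G) f y) (hg : MDifferentiableAt I 𝓘(ℝ, G') g y)
    (X : TangentSpace I y) :
    mvfderiv I (fun z ↦ B (f z) (g z)) y X =
      B (f y) (mvfderiv I g y X) + B (mvfderiv I f y X) (g y) := by
  have hy := mem_extChartAt_source (I := I) y
  have hB : MDifferentiableAt I 𝓘(ℝ, G'') (fun z ↦ B (f z) (g z)) y :=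
    (B.mdifferentiableAt.comp y hf).clm_apply hg
  obtain ⟨v, rfl⟩ : ∃ v : E, coordField I y v y = X := ⟨_, coordField_mfderiv_extChartAt hy X⟩
  rw [mvfderiv_coordField hy hB, mvfderiv_coordField hy hf, mvfderiv_coordField hy hg]
  have h := B.fderivWithin_of_bilinear (differentiableWithinAt_comp_extChartAt_symm hy hf)
    (differentiableWithinAt_comp_extChartAt_symm hy hg)
    (I.uniqueDiffOn _ (extChartAt_target_subset_range y (mem_extChartAt_target y)))
  simp only [Function.comp_apply, extChartAt_to_inv] at h
  exact congr($h v)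

theorem mvfderiv_clm_comp (B : G →L[ℝ] G') {f : M → G} (hf : MDifferentiableAt I 𝓘(ℝ, G) f y)
    (X : TangentSpace I y) : mvfderiv I (fun z ↦ B (f z)) y X = B (mvfderiv I f y X) := by
  simpa [mvfderiv_const] using
    mvfderiv_bilinear (ContinuousLinearMap.apply ℝ G' (E := G)) hf mdifferentiableAt_const X

variable (I) in
/-- The derivative of a vector-valued function in the direction of `v`, in the coordinates of the
chart at `c`. -/
def coordDeriv (c : M) (v : E) (f : M → G) (y : M) : G :=
  mvfderiv I f y (coordField I c v y)

theorem coordDeriv_congr {f g : M → G} (h : f =ᶠ[𝓝 y] g) :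
    coordDeriv I c v f =ᶠ[𝓝 y] coordDeriv I c v g := by
  filter_upwards [h.eventuallyEq_nhds] with z hz
  rw [coordDeriv, mvfderiv_congr hz, coordDeriv]

theorem coordDeriv_comp_extChartAt_symm (hy : y ∈ (extChartAt I c).source) {f : M → G}
    (hf : ContMDiffAt I 𝓘(ℝ, G) ∞ f y) :
    coordDeriv I c v f ∘ (extChartAt I c).symm =ᶠ[𝓝[range I] (extChartAt I c y)]
      fun p ↦ fderivWithin ℝ (f ∘ (extChartAt I c).symm) (range I) p v := by
  have hp := (extChartAt I c).map_source hy
  have hdiff : ∀ᶠ z in 𝓝 y, MDifferentiableAt I 𝓘(ℝ, G) f z := by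
    have : IsManifold I 1 M := .of_le (n := ∞) (by simp)
    filter_upwards [(contMDiffAt_iff_contMDiffAt_nhds (n := 1) (by simp)).1
      (ContMDiffAt.of_le hf (by simp))] with z hz
    exact hz.mdifferentiableAt (by simp)
  have hcont : Filter.Tendsto (extChartAt I c).symm (𝓝[range I] (extChartAt I c y)) (𝓝 y) := by
    have := (contMDiffWithinAt_extChartAt_symm_range (n := 0) c hp).continuousWithinAt.tendsto
    rwa [(extChartAt I c).left_inv hy] at this
  filter_upwards [hcont.eventually hdiff, extChartAt_target_mem_nhdsWithin_of_mem hp] with q hq hqc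
  rw [Function.comp_apply, coordDeriv, mvfderiv_coordField ((extChartAt I c).map_target hqc) hq,
    (extChartAt I c).right_inv hqc]

theorem contMDiffAt_coordDeriv (hy : y ∈ (extChartAt I c).source) {f : M → G}
    (hf : ContMDiffAt I 𝓘(ℝ, G) ∞ f y) : ContMDiffAt I 𝓘(ℝ, G) ∞ (coordDeriv I c v f) y := by
  have hp := extChartAt_target_subset_range c ((extChartAt I c).map_source hy)
  rw [contMDiffAt_iff_contDiffWithinAt_comp_extChartAt_symm hy]
  exact (((contMDiffAt_iff_contDiffWithinAt_comp_extChartAt_symm hy).1 hf).fderivWithin_right_apply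
    contDiffWithinAt_const I.uniqueDiffOn (by simp) hp).congr_of_eventuallyEq_of_mem
    (coordDeriv_comp_extChartAt_symm hy hf) hp

theorem coordDeriv_coordDeriv (hy : y ∈ (extChartAt I c).source) {f : M → G}
    (hf : ContMDiffAt I 𝓘(ℝ, G) ∞ f y) :
    coordDeriv I c v (coordDeriv I c w f) y =
      fderivWithin ℝ (fderivWithin ℝ (f ∘ (extChartAt I c).symm) (range I)) (range I)
        (extChartAt I c y) v w := by
  have hp := extChartAt_target_subset_range c ((extChartAt I c).map_source hy)
  have hd := (((contMDiffAt_iff_contDiffWithinAt_comp_extChartAt_symm hy).1 hf).fderivWithin_right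
    (m := ∞) I.uniqueDiffOn (by simp) hp).differentiableWithinAt (by simp)
  rw [coordDeriv, mvfderiv_coordField hy ((contMDiffAt_coordDeriv hy hf).mdifferentiableAt
    (by simp)), (coordDeriv_comp_extChartAt_symm hy hf).fderivWithin_eq_of_mem hp,
    fderivWithin_clm_apply (I.uniqueDiffOn _ hp) hd (differentiableWithinAt_const _)]
  simp

theorem coordDeriv_comm (hy : y ∈ (extChartAt I c).source) {f : M → G}
    (hf : ContMDiffAt I 𝓘(ℝ, G) ∞ f y) :
    coordDeriv I c v (coordDeriv I c w f) y = coordDeriv I c w (coordDeriv I c v f) y := by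
  have hp := extChartAt_target_subset_range c ((extChartAt I c).map_source hy)
  rw [coordDeriv_coordDeriv hy hf, coordDeriv_coordDeriv hy hf]
  exact ((contMDiffAt_iff_contDiffWithinAt_comp_extChartAt_symm hy).1 hf).isSymmSndFDerivWithinAt
    (by simpa using ENat.LEInfty.out) I.uniqueDiffOn (I.range_subset_closure_interior hp) hp v w

end CoordinateDerivatives

section Boundary

theorem mem_boundary_iff_extChartAt {n : ℕ} {M : Type*} [TopologicalSpace M]
    [ChartedSpace (EuclideanHalfSpace (n + 1)) M] [IsManifold (𝓡∂ (n + 1)) ∞ M] {c x : M}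
    (hx : x ∈ (extChartAt (𝓡∂ (n + 1)) c).source) :
    x ∈ (𝓡∂ (n + 1)).boundary M ↔ extChartAt (𝓡∂ (n + 1)) c x 0 = 0 := by
  have hx' : x ∈ (chartAt (EuclideanHalfSpace (n + 1)) c).source := by simpa using hx
  have hnonneg : 0 ≤ extChartAt (𝓡∂ (n + 1)) c x 0 := mem_range_halfSpace.1
    (extChartAt_target_subset_range c ((extChartAt (𝓡∂ (n + 1)) c).map_source hx))
  have hboundary : x ∈ (𝓡∂ (n + 1)).boundary M ↔
      extChartAt (𝓡∂ (n + 1)) c x ∉ interior (extChartAt (𝓡∂ (n + 1)) c).target :=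
    ((𝓡∂ (n + 1)).isBoundaryPoint_iff_not_isInteriorPoint x).trans (not_congr
      ((𝓡∂ (n + 1)).isInteriorPoint_iff_of_mem_atlas (n := ∞) (by simp)
        (chart_mem_atlas (EuclideanHalfSpace (n + 1)) c) hx'))
  have hinterior : extChartAt (𝓡∂ (n + 1)) c x ∈ interior (extChartAt (𝓡∂ (n + 1)) c).target ↔
      extChartAt (𝓡∂ (n + 1)) c x ∈ interior (range (𝓡∂ (n + 1))) :=
    ⟨fun h ↦ OpenPartialHomeomorph.interior_extend_target_subset_interior_range _ h,
      (chartAt _ c).mem_interior_extend_target ((chartAt _ c).map_source hx')⟩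
  rw [hboundary, hinterior, interior_range_modelWithCornersEuclideanHalfSpace]
  simp only [mem_ofPred_eq, not_lt]
  exact ⟨fun h ↦ le_antisymm h hnonneg, fun h ↦ h.le⟩

theorem fderivWithin_halfSpace_eq_zero_of_isMinOn {n : ℕ} {f : EuclideanSpace ℝ (Fin (n + 1)) → ℝ}
    {p v : EuclideanSpace ℝ (Fin (n + 1))} (hp : p ∈ range (𝓡∂ (n + 1))) (hv : v 0 = 0)
    (hf : IsMinOn f (range (𝓡∂ (n + 1))) p) : fderivWithin ℝ f (range (𝓡∂ (n + 1))) p v = 0 := by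
  have htangent : ∀ w : EuclideanSpace ℝ (Fin (n + 1)), w 0 = 0 →
      w ∈ posTangentConeAt (range (𝓡∂ (n + 1))) p := fun w hw ↦
    mem_posTangentConeAt_of_segment_subset ((𝓡∂ (n + 1)).convex_range.segment_subset hp
      (mem_range_halfSpace.2 (by simpa [hw] using mem_range_halfSpace.1 hp)))
  exact hf.localize.fderivWithin_eq_zero (htangent v hv) (htangent (-v) (by simp [hv]))

variable {M : Type*} [TopologicalSpace M] [ChartedSpace (EuclideanHalfSpace 2) M]
  [IsManifold (𝓡∂ 2) ∞ M]

theorem coordField_mem_boundaryTangent {c x : M} (hx : x ∈ (extChartAt (𝓡∂ 2) c).source)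
    (hb : x ∈ (𝓡∂ 2).boundary M) {v : EuclideanSpace ℝ (Fin 2)} (hv : v 0 = 0) :
    coordField (𝓡∂ 2) c v x ∈ boundaryTangent x := by
  have hp := extChartAt_target_subset_range c ((extChartAt (𝓡∂ 2) c).map_source hx)
  have hxx : x ∈ (extChartAt (𝓡∂ 2) x).source := mem_extChartAt_source x
  have hdiff := differentiableWithinAt_comp_extChartAt_symm hx
    (mdifferentiableAt_extChartAt (I := 𝓡∂ 2) (x := x) (by simp))
  have hmin : IsMinOn (fun p ↦ extChartAt (𝓡∂ 2) x ((extChartAt (𝓡∂ 2) c).symm p) 0)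
      (range (𝓡∂ 2)) (extChartAt (𝓡∂ 2) c x) := fun p _ ↦ by
    simp only [mem_ofPred_eq, (extChartAt (𝓡∂ 2) c).left_inv hx,
      (mem_boundary_iff_extChartAt hxx).1 hb]
    exact mem_range_halfSpace.1 (mem_range_self _)
  rw [coordField_eq_coordField_fderivWithin hx hxx, coordField_eq_mfderivWithin hxx,
    mfderivWithin_range_extChartAt_symm]
  have hzero := fderivWithin_halfSpace_eq_zero_of_isMinOn hp hv hmin
  have hcomp := (EuclideanSpace.proj (𝕜 := ℝ) (0 : Fin 2)).hasFDerivAt.comp_hasFDerivWithinAt _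
    hdiff.hasFDerivWithinAt
  exact (congr($(hcomp.fderivWithin ((𝓡∂ 2).uniqueDiffOn _ hp)) v)).symm.trans hzero

end Boundary

section ChangeOfCharts

theorem det_eq_sub_of_single (T : EuclideanSpace ℝ (Fin 2) →L[ℝ] EuclideanSpace ℝ (Fin 2)) :
    T.det = T (EuclideanSpace.single 0 1) 0 * T (EuclideanSpace.single 1 1) 1 -
      T (EuclideanSpace.single 1 1) 0 * T (EuclideanSpace.single 0 1) 1 := by
  rw [ContinuousLinearMap.det,
    ← LinearMap.det_toMatrix (EuclideanSpace.basisFun (Fin 2) ℝ).toBasis, Matrix.det_fin_two]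
  simp [LinearMap.toMatrix_apply]

theorem isAlt_apply_map_single {G : Type*} [AddCommGroup G] [Module ℝ G]
    {b : EuclideanSpace ℝ (Fin 2) →ₗ[ℝ] EuclideanSpace ℝ (Fin 2) →ₗ[ℝ] G} (hb : b.IsAlt)
    (T : EuclideanSpace ℝ (Fin 2) →L[ℝ] EuclideanSpace ℝ (Fin 2)) :
    b (T (EuclideanSpace.single 0 1)) (T (EuclideanSpace.single 1 1)) =
      T.det • b (EuclideanSpace.single 0 1) (EuclideanSpace.single 1 1) := by
  have hsum : ∀ w : EuclideanSpace ℝ (Fin 2),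
      w = w 0 • EuclideanSpace.single 0 1 + w 1 • EuclideanSpace.single 1 1 := fun w ↦ by
    ext i; fin_cases i <;> simp
  rw [hsum (T (EuclideanSpace.single 0 1)), hsum (T (EuclideanSpace.single 1 1)),
    det_eq_sub_of_single]
  simp only [map_add, map_smul, LinearMap.add_apply, LinearMap.smul_apply, hb.self_eq_zero]
  rw [← hb.neg (EuclideanSpace.single 0 1)]
  module

theorem det_nonneg_of_commute_rot {T : EuclideanSpace ℝ (Fin 2) →L[ℝ] EuclideanSpace ℝ (Fin 2)}
    (hT : ∀ v, T (rot v) = rot (T v)) : 0 ≤ T.det := by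
  have hrot : EuclideanSpace.single 1 1 = rot (EuclideanSpace.single 0 1) := by
    ext i; fin_cases i <;> simp [rot]
  have hdet : T.det =
      T (EuclideanSpace.single 0 1) 0 ^ 2 + T (EuclideanSpace.single 0 1) 1 ^ 2 := by
    rw [det_eq_sub_of_single, hrot, hT]
    simp only [rot, PiLp.toLp_apply, Matrix.cons_val_zero, Matrix.cons_val_one]
    ring
  rw [hdet]
  positivity

variable {M : Type*} [TopologicalSpace M] [ChartedSpace (EuclideanHalfSpace 2) M]

theorem measurableSet_extChartAt_target (c : M) :
    MeasurableSet (extChartAt (𝓡∂ 2) c).target := by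
  rw [extChartAt_target]
  exact (((chartAt (EuclideanHalfSpace 2) c).open_target.preimage
    (𝓡∂ 2).continuous_symm).measurableSet).inter (𝓡∂ 2).isClosed_range.measurableSet

theorem measurableSet_extChartAt_symm_trans_source (c c' : M) :
    MeasurableSet ((extChartAt (𝓡∂ 2) c).symm ≫ extChartAt (𝓡∂ 2) c').source := by
  obtain ⟨u, hu, h⟩ := continuousOn_iff'.1 (continuousOn_extChartAt_symm (I := 𝓡∂ 2) c) _
    (isOpen_extChartAt_source (I := 𝓡∂ 2) c')
  rw [PartialEquiv.trans_source, PartialEquiv.symm_source, inter_comm, h]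
  exact hu.measurableSet.inter (measurableSet_extChartAt_target c)

/-- The coefficient `α(∂/∂x₀, ∂/∂x₁)` of a `2`-form in the chart at `c`, as a function of the
coordinates. -/
def chartCoeff (c : M) (α : Π y : M, TangentSpace (𝓡∂ 2) y → TangentSpace (𝓡∂ 2) y → ℂ)
    (p : EuclideanSpace ℝ (Fin 2)) : ℂ :=
  α ((extChartAt (𝓡∂ 2) c).symm p) (coordVec c p 0) (coordVec c p 1)

/-- The same coefficient, as a function on `M` (meaningful in the domain of the chart at `c`). -/
def coordCoeff [IsManifold (𝓡∂ 2) ∞ M] (c : M)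
    (α : Π y : M, TangentSpace (𝓡∂ 2) y → TangentSpace (𝓡∂ 2) y → ℂ) (y : M) : ℂ :=
  α y (coordField (𝓡∂ 2) c (EuclideanSpace.single 0 1) y)
    (coordField (𝓡∂ 2) c (EuclideanSpace.single 1 1) y)

theorem chartCoeff_eq_coordCoeff [IsManifold (𝓡∂ 2) ∞ M] {c : M} {p : EuclideanSpace ℝ (Fin 2)}
    (hp : p ∈ (extChartAt (𝓡∂ 2) c).target)
    (α : Π y : M, TangentSpace (𝓡∂ 2) y → TangentSpace (𝓡∂ 2) y → ℂ) :
    chartCoeff c α p = coordCoeff c α ((extChartAt (𝓡∂ 2) c).symm p) := by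
  rw [chartCoeff, coordVec_eq_coordField hp, coordVec_eq_coordField hp, coordCoeff]

theorem continuousOn_chartCoeff [IsManifold (𝓡∂ 2) ∞ M] {c : M}
    {α : Π y : M, TangentSpace (𝓡∂ 2) y → TangentSpace (𝓡∂ 2) y → ℂ}
    (hα : ContinuousOn (coordCoeff c α) (extChartAt (𝓡∂ 2) c).source) :
    ContinuousOn (chartCoeff c α) (extChartAt (𝓡∂ 2) c).target :=
  (hα.comp (continuousOn_extChartAt_symm c) (extChartAt (𝓡∂ 2) c).mapsTo_symm).congr
    fun _ hp ↦ chartCoeff_eq_coordCoeff hp α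

theorem chartCoeff_eq_det_smul_chartCoeff [IsManifold (𝓡∂ 2) ∞ M] {c c' : M}
    (α : Π y : M, TangentSpace (𝓡∂ 2) y →ₗ[ℝ] TangentSpace (𝓡∂ 2) y →ₗ[ℝ] ℂ)
    (hα : ∀ y, (α y).IsAlt) {p : EuclideanSpace ℝ (Fin 2)}
    (hp : p ∈ ((extChartAt (𝓡∂ 2) c).symm ≫ extChartAt (𝓡∂ 2) c').source) :
    chartCoeff c (fun y X Y ↦ α y X Y) p =
      (fderivWithin ℝ (extChartAt (𝓡∂ 2) c' ∘ (extChartAt (𝓡∂ 2) c).symm) (range (𝓡∂ 2)) p).det •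
        chartCoeff c' (fun y X Y ↦ α y X Y)
          (extChartAt (𝓡∂ 2) c' ((extChartAt (𝓡∂ 2) c).symm p)) := by
  obtain ⟨hpc, hpc'⟩ : p ∈ (extChartAt (𝓡∂ 2) c).target ∧
    (extChartAt (𝓡∂ 2) c).symm p ∈ (extChartAt (𝓡∂ 2) c').source := hp
  obtain ⟨y, hyc, rfl⟩ : ∃ y ∈ (extChartAt (𝓡∂ 2) c).source, extChartAt (𝓡∂ 2) c y = p :=
    ⟨_, (extChartAt (𝓡∂ 2) c).map_target hpc, (extChartAt (𝓡∂ 2) c).right_inv hpc⟩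
  rw [(extChartAt (𝓡∂ 2) c).left_inv hyc] at hpc' ⊢
  rw [chartCoeff_eq_coordCoeff hpc,
    chartCoeff_eq_coordCoeff ((extChartAt (𝓡∂ 2) c').map_source hpc'),
    (extChartAt (𝓡∂ 2) c).left_inv hyc, (extChartAt (𝓡∂ 2) c').left_inv hpc', coordCoeff,
    coordField_eq_coordField_fderivWithin hyc hpc', coordField_eq_coordField_fderivWithin hyc hpc']
  set L : EuclideanSpace ℝ (Fin 2) →ₗ[ℝ] TangentSpace (𝓡∂ 2) y :=
    ((trivializationAt _ (TangentSpace (𝓡∂ 2)) c').symmL ℝ y).toLinearMap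
  have hL : ((α y).compl₁₂ L L).IsAlt := fun v ↦ hα y (L v)
  exact isAlt_apply_map_single hL _

theorem integral_chartCoeff_eq_integral_symm_trans_source {c c' : M}
    {α : Π y : M, TangentSpace (𝓡∂ 2) y → TangentSpace (𝓡∂ 2) y → ℂ}
    (hα : ∀ y ∉ (extChartAt (𝓡∂ 2) c').source, α y = 0) :
    ∫ p in (extChartAt (𝓡∂ 2) c).target, chartCoeff c α p =
      ∫ p in ((extChartAt (𝓡∂ 2) c).symm ≫ extChartAt (𝓡∂ 2) c').source, chartCoeff c α p := by
  refine setIntegral_eq_of_subset_of_forall_sdiff_eq_zero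
    (measurableSet_extChartAt_target c) inter_subset_left fun p hp ↦ ?_
  have hzero : α ((extChartAt (𝓡∂ 2) c).symm p) = 0 := hα _ fun h ↦ hp.2 ⟨hp.1, h⟩
  rw [chartCoeff, hzero]
  rfl

theorem integral_chartCoeff_eq_integral_chartCoeff [IsRiemannSurface M] {c c' : M}
    (α : Π y : M, TangentSpace (𝓡∂ 2) y →ₗ[ℝ] TangentSpace (𝓡∂ 2) y →ₗ[ℝ] ℂ)
    (hα : ∀ y, (α y).IsAlt) (hc : ∀ y ∉ (extChartAt (𝓡∂ 2) c).source, α y = 0)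
    (hc' : ∀ y ∉ (extChartAt (𝓡∂ 2) c').source, α y = 0) :
    ∫ p in (extChartAt (𝓡∂ 2) c).target, chartCoeff c (fun y X Y ↦ α y X Y) p =
      ∫ p in (extChartAt (𝓡∂ 2) c').target, chartCoeff c' (fun y X Y ↦ α y X Y) p := by
  set τ := (extChartAt (𝓡∂ 2) c).symm ≫ extChartAt (𝓡∂ 2) c'
  have hmeas : MeasurableSet τ.source := measurableSet_extChartAt_symm_trans_source c c'
  have hderiv : ∀ p ∈ τ.source,
      HasFDerivWithinAt τ (fderivWithin ℝ τ (range (𝓡∂ 2)) p) τ.source p := fun p hp ↦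
    ((contDiffWithinAt_ext_coord_change (n := ∞) c' c hp).differentiableWithinAt
      (by simp)).hasFDerivWithinAt.mono
        (inter_subset_left.trans (extChartAt_target_subset_range c))
  have hpos : ∀ p ∈ τ.source, 0 ≤ (fderivWithin ℝ τ (range (𝓡∂ 2)) p).det := fun p hp ↦
    det_nonneg_of_commute_rot (IsRiemannSurface.holomorphic _ (chart_mem_atlas _ c) _
      (chart_mem_atlas _ c') p hp)
  have hsymm : ((extChartAt (𝓡∂ 2) c').symm ≫ extChartAt (𝓡∂ 2) c).source = τ '' τ.source := by
    rw [τ.image_source_eq_target]; rfl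
  rw [integral_chartCoeff_eq_integral_symm_trans_source fun y hy ↦ by rw [hc' y hy]; rfl,
    integral_chartCoeff_eq_integral_symm_trans_source fun y hy ↦ by rw [hc y hy]; rfl, hsymm,
    integral_image_eq_integral_abs_det_fderiv_smul volume hmeas hderiv τ.injOn]
  refine setIntegral_congr_fun hmeas fun p hp ↦ ?_
  rw [chartCoeff_eq_det_smul_chartCoeff α hα hp, abs_of_nonneg (hpos p hp)]
  rfl

end ChangeOfCharts

section SurfaceIntegral

variable {M : Type*} [TopologicalSpace M] [ChartedSpace (EuclideanHalfSpace 2) M]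

/-- A possibly non-alternating `2`-form has continuous coefficients in all charts. -/
def HasContinuousCoeffs [IsManifold (𝓡∂ 2) ∞ M]
    (α : Π y : M, TangentSpace (𝓡∂ 2) y → TangentSpace (𝓡∂ 2) y → ℂ) : Prop :=
  ∀ c, ContinuousOn (coordCoeff c α) (extChartAt (𝓡∂ 2) c).source

theorem integrableOn_chartCoeff [T2Space M] [IsManifold (𝓡∂ 2) ∞ M] {c : M} {K : Set M}
    (hK : IsCompact K) (hKc : K ⊆ (extChartAt (𝓡∂ 2) c).source)
    {α : Π y : M, TangentSpace (𝓡∂ 2) y → TangentSpace (𝓡∂ 2) y → ℂ}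
    (hα : ContinuousOn (coordCoeff c α) (extChartAt (𝓡∂ 2) c).source)
    (hαK : ∀ y ∉ K, α y = 0) :
    IntegrableOn (chartCoeff c α) (extChartAt (𝓡∂ 2) c).target := by
  have hsub : extChartAt (𝓡∂ 2) c '' K ⊆ (extChartAt (𝓡∂ 2) c).target :=
    ((extChartAt (𝓡∂ 2) c).mapsTo.mono_left hKc).image_subset
  have hcompact := hK.image_of_continuousOn ((continuousOn_extChartAt c).mono hKc)
  refine (((continuousOn_chartCoeff hα).mono hsub).integrableOn_compact hcompact
    ).of_forall_sdiff_eq_zero (measurableSet_extChartAt_target c) fun p hp ↦ ?_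
  have hpK : (extChartAt (𝓡∂ 2) c).symm p ∉ K := fun h ↦
    hp.2 ⟨_, h, (extChartAt (𝓡∂ 2) c).right_inv hp.1⟩
  rw [chartCoeff, hαK _ hpK]
  rfl

variable [T2Space M] [CompactSpace M]

theorem tsupport_chartPartition_subset [IsManifold (𝓡∂ 2) ∞ M] (c : M) :
    tsupport (chartPartition (M := M) c) ⊆ (extChartAt (𝓡∂ 2) c).source := by
  rw [extChartAt_source]
  exact (SmoothPartitionOfUnity.exists_isSubordinate_chartAt_source (𝓡∂ 2) M).choose_spec c

theorem exists_finset_chartPartition [IsManifold (𝓡∂ 2) ∞ M] :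
    ∃ S : Finset M, (∀ c ∉ S, ∀ y, chartPartition (M := M) c y = 0) ∧
      ∀ y, ∑ c ∈ S, chartPartition (M := M) c y = 1 := by
  have hfin := (chartPartition (M := M)).locallyFinite.finite_nonempty_of_compact
  have hzero : ∀ c ∉ hfin.toFinset, ∀ y, chartPartition (M := M) c y = 0 := by
    intro c hc y
    by_contra hne
    exact hc (hfin.mem_toFinset.2 ⟨y, hne⟩)
  refine ⟨hfin.toFinset, hzero, fun y ↦ ?_⟩
  rw [← (chartPartition (M := M)).sum_eq_one (mem_univ y)]
  refine (finsum_eq_sum_of_support_subset _ fun c hc ↦ ?_).symm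
  by_contra hne
  exact hc (hzero c hne y)

variable [IsRiemannSurface M]

theorem surfaceIntegral_eq_sum {S : Finset M}
    (hS : ∀ c ∉ S, ∀ y, chartPartition (M := M) c y = 0)
    (α : Π y : M, TangentSpace (𝓡∂ 2) y → TangentSpace (𝓡∂ 2) y → ℂ) :
    surfaceIntegral α = ∑ c ∈ S, ∫ p in (extChartAt (𝓡∂ 2) c).target,
      chartCoeff c (fun y X Y ↦ (chartPartition (M := M) c y : ℂ) * α y X Y) p := by
  refine finsum_eq_sum_of_support_subset _ fun c hc ↦ ?_
  by_contra hne
  exact hc (by simp [hS c hne])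

theorem integrableOn_chartCoeff_chartPartition_mul {c : M}
    {α : Π y : M, TangentSpace (𝓡∂ 2) y → TangentSpace (𝓡∂ 2) y → ℂ}
    (hα : ContinuousOn (coordCoeff c α) (extChartAt (𝓡∂ 2) c).source) :
    IntegrableOn (chartCoeff c fun y X Y ↦ (chartPartition (M := M) c y : ℂ) * α y X Y)
      (extChartAt (𝓡∂ 2) c).target := by
  refine integrableOn_chartCoeff (isClosed_tsupport _).isCompact
    (tsupport_chartPartition_subset c) ?_ fun y hy ↦ ?_
  · exact (Complex.continuous_ofReal.comp (chartPartition (M := M) c).contMDiff.continuous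
      ).continuousOn.mul hα
  · ext X Y
    simp [image_eq_zero_of_notMem_tsupport hy]

theorem surfaceIntegral_sub
    {α α' : Π y : M, TangentSpace (𝓡∂ 2) y → TangentSpace (𝓡∂ 2) y → ℂ}
    (hα : HasContinuousCoeffs α) (hα' : HasContinuousCoeffs α') :
    surfaceIntegral (fun y X Y ↦ α y X Y - α' y X Y) =
      surfaceIntegral α - surfaceIntegral α' := by
  obtain ⟨S, hS, -⟩ := exists_finset_chartPartition (M := M)
  simp only [surfaceIntegral_eq_sum hS, ← Finset.sum_sub_distrib]
  refine Finset.sum_congr rfl fun c _ ↦ ?_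
  rw [← integral_sub (integrableOn_chartCoeff_chartPartition_mul (hα c))
    (integrableOn_chartCoeff_chartPartition_mul (hα' c))]
  simp only [chartCoeff, mul_sub]

theorem surfaceIntegral_finset_sum {ι : Type*} (s : Finset ι)
    {α : ι → Π y : M, TangentSpace (𝓡∂ 2) y → TangentSpace (𝓡∂ 2) y → ℂ}
    (hα : ∀ i ∈ s, HasContinuousCoeffs (α i)) :
    surfaceIntegral (fun y X Y ↦ ∑ i ∈ s, α i y X Y) = ∑ i ∈ s, surfaceIntegral (α i) := by
  obtain ⟨S, hS, -⟩ := exists_finset_chartPartition (M := M)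
  simp only [surfaceIntegral_eq_sum hS]
  rw [Finset.sum_comm]
  refine Finset.sum_congr rfl fun c _ ↦ ?_
  rw [← integral_finsetSum _ fun i hi ↦ integrableOn_chartCoeff_chartPartition_mul (hα i hi c)]
  simp only [chartCoeff, Finset.mul_sum]

theorem surfaceIntegral_eq_integral_chartCoeff {c : M} {K : Set M} (hK : IsCompact K)
    (hKc : K ⊆ (extChartAt (𝓡∂ 2) c).source)
    (α : Π y : M, TangentSpace (𝓡∂ 2) y →ₗ[ℝ] TangentSpace (𝓡∂ 2) y →ₗ[ℝ] ℂ)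
    (hα : ∀ y, (α y).IsAlt)
    (hcont : ContinuousOn (coordCoeff c fun y X Y ↦ α y X Y) (extChartAt (𝓡∂ 2) c).source)
    (hαK : ∀ y ∉ K, α y = 0) :
    surfaceIntegral (fun y X Y ↦ α y X Y) =
      ∫ p in (extChartAt (𝓡∂ 2) c).target, chartCoeff c (fun y X Y ↦ α y X Y) p := by
  obtain ⟨S, hS, hS₁⟩ := exists_finset_chartPartition (M := M)
  have hchange : ∀ a, ∫ p in (extChartAt (𝓡∂ 2) a).target,
      chartCoeff a (fun y X Y ↦ (chartPartition (M := M) a y : ℂ) * α y X Y) p =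
      ∫ p in (extChartAt (𝓡∂ 2) c).target,
        chartCoeff c (fun y X Y ↦ (chartPartition (M := M) a y : ℂ) * α y X Y) p := fun a ↦ by
    refine integral_chartCoeff_eq_integral_chartCoeff
      (fun y ↦ (chartPartition (M := M) a y : ℂ) • α y) (fun y X ↦ ?_) (fun y hy ↦ ?_)
      fun y hy ↦ ?_
    · simp [(hα y).self_eq_zero]
    · simp [image_eq_zero_of_notMem_tsupport fun h ↦ hy (tsupport_chartPartition_subset a h)]
    · simp [hαK y fun h ↦ hy (hKc h)]
  have hint : ∀ a ∈ S, IntegrableOn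
      (chartCoeff c fun y X Y ↦ (chartPartition (M := M) a y : ℂ) * α y X Y)
      (extChartAt (𝓡∂ 2) c).target := fun a _ ↦ by
    refine integrableOn_chartCoeff hK hKc ?_ fun y hy ↦ ?_
    · exact (Complex.continuous_ofReal.comp (chartPartition (M := M) a).contMDiff.continuous
        ).continuousOn.mul hcont
    · ext X Y
      simp [hαK y hy]
  rw [surfaceIntegral_eq_sum hS, Finset.sum_congr rfl fun a _ ↦ hchange a,
    ← integral_finsetSum _ hint]
  simp only [chartCoeff, ← Finset.sum_mul, ← Complex.ofReal_sum, hS₁, Complex.ofReal_one, one_mul]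

end SurfaceIntegral

section Stokes

variable {M : Type*} [TopologicalSpace M] [ChartedSpace (EuclideanHalfSpace 2) M]
  {f : M → ℝ} {β : Π y : M, TangentSpace (𝓡∂ 2) y →ₗ[ℝ] ℂ} {c y : M}

/-- The wedge product `df ∧ β` of the differential of a function and a `1`-form. -/
def dWedge (f : M → ℝ) (β : Π y : M, TangentSpace (𝓡∂ 2) y →ₗ[ℝ] ℂ) (y : M) :
    TangentSpace (𝓡∂ 2) y →ₗ[ℝ] TangentSpace (𝓡∂ 2) y →ₗ[ℝ] ℂ :=
  LinearMap.mk₂ ℝ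
    (fun X Y ↦ mvfderiv (𝓡∂ 2) f y X • β y Y - mvfderiv (𝓡∂ 2) f y Y • β y X)
    (fun X X' Y ↦ by simp only [map_add]; module) (fun a X Y ↦ by simp only [map_smul]; module)
    (fun X Y Y' ↦ by simp only [map_add]; module) (fun a X Y ↦ by simp only [map_smul]; module)

theorem dWedge_apply (f : M → ℝ) (β : Π y : M, TangentSpace (𝓡∂ 2) y →ₗ[ℝ] ℂ) (y : M)
    (X Y : TangentSpace (𝓡∂ 2) y) : dWedge f β y X Y =
      mvfderiv (𝓡∂ 2) f y X • β y Y - mvfderiv (𝓡∂ 2) f y Y • β y X := rfl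

theorem isAlt_dWedge (f : M → ℝ) (β : Π y : M, TangentSpace (𝓡∂ 2) y →ₗ[ℝ] ℂ) (y : M) :
    (dWedge f β y).IsAlt := fun X ↦ by rw [dWedge_apply, sub_self]

theorem dWedge_eq_zero_of_notMem_tsupport (hy : y ∉ tsupport f) : dWedge f β y = 0 := by
  ext X Y
  simp [dWedge_apply, mvfderiv_eq_zero_of_notMem_tsupport hy]

theorem sum_dWedge_eq_zero {ι : Type*} (s : Finset ι) {f : ι → M → ℝ}
    (hf : ∀ i ∈ s, MDifferentiableAt (𝓡∂ 2) 𝓘(ℝ, ℝ) (f i) y) {a : ℝ}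
    (hs : ∀ z, ∑ i ∈ s, f i z = a) (X Y : TangentSpace (𝓡∂ 2) y) :
    ∑ i ∈ s, dWedge (f i) β y X Y = 0 := by
  have hzero : ∑ i ∈ s, mvfderiv (𝓡∂ 2) (f i) y = 0 := by
    rw [← mvfderiv_finset_sum s hf, funext hs, mvfderiv_const]
  have happly : ∀ Z, ∑ i ∈ s, mvfderiv (𝓡∂ 2) (f i) y Z = 0 := fun Z ↦ by
    simpa using congr($hzero Z)
  simp only [dWedge_apply, Finset.sum_sub_distrib, ← Finset.sum_smul, happly, zero_smul, sub_zero]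

variable [IsManifold (𝓡∂ 2) ∞ M]

/-- The coefficient `β(∂/∂x_k)` of a `1`-form in the chart at `c`, as a function on `M`. -/
def oneFormCoeff (c : M) (β : Π y : M, TangentSpace (𝓡∂ 2) y →ₗ[ℝ] ℂ) (k : Fin 2) (y : M) : ℂ :=
  β y (coordField (𝓡∂ 2) c (EuclideanSpace.single k 1) y)

/-- A `1`-form is smooth if its coefficients in all charts are. -/
def IsSmoothOneForm (β : Π y : M, TangentSpace (𝓡∂ 2) y →ₗ[ℝ] ℂ) : Prop :=
  ∀ c k, ∀ y ∈ (extChartAt (𝓡∂ 2) c).source,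
    ContMDiffAt (𝓡∂ 2) 𝓘(ℝ, ℂ) ∞ (oneFormCoeff c β k) y

/-- `α = dβ`, expressed through the coefficients in all charts. -/
def IsExteriorDeriv (α : Π y : M, TangentSpace (𝓡∂ 2) y → TangentSpace (𝓡∂ 2) y → ℂ)
    (β : Π y : M, TangentSpace (𝓡∂ 2) y →ₗ[ℝ] ℂ) : Prop :=
  ∀ c, ∀ y ∈ (extChartAt (𝓡∂ 2) c).source, coordCoeff c α y =
    coordDeriv (𝓡∂ 2) c (EuclideanSpace.single 0 1) (oneFormCoeff c β 1) y -
      coordDeriv (𝓡∂ 2) c (EuclideanSpace.single 1 1) (oneFormCoeff c β 0) y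

variable {α : Π y : M, TangentSpace (𝓡∂ 2) y → TangentSpace (𝓡∂ 2) y → ℂ}

theorem IsExteriorDeriv.hasContinuousCoeffs (hα : IsExteriorDeriv α β) (hβ : IsSmoothOneForm β) :
    HasContinuousCoeffs α := fun c ↦
  ContinuousOn.congr (fun y hy ↦
    ((contMDiffAt_coordDeriv hy (hβ c 1 y hy)).continuousAt.sub
      (contMDiffAt_coordDeriv hy (hβ c 0 y hy)).continuousAt).continuousWithinAt) (hα c)

theorem hasContinuousCoeffs_dWedge (hf : ContMDiff (𝓡∂ 2) 𝓘(ℝ, ℝ) ∞ f) (hβ : IsSmoothOneForm β) :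
    HasContinuousCoeffs fun y X Y ↦ dWedge f β y X Y := fun c y hy ↦
  (((contMDiffAt_coordDeriv hy (hf y)).continuousAt.smul (hβ c 1 y hy).continuousAt).sub
    ((contMDiffAt_coordDeriv hy (hf y)).continuousAt.smul
      (hβ c 0 y hy).continuousAt)).continuousWithinAt

theorem coordDeriv_smul {v : EuclideanSpace ℝ (Fin 2)} {g : M → ℂ}
    (hf : MDifferentiableAt (𝓡∂ 2) 𝓘(ℝ, ℝ) f y) (hg : MDifferentiableAt (𝓡∂ 2) 𝓘(ℝ, ℂ) g y) :
    coordDeriv (𝓡∂ 2) c v (fun z ↦ f z • g z) y =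
      f y • coordDeriv (𝓡∂ 2) c v g y + coordDeriv (𝓡∂ 2) c v f y • g y := by
  rw [coordDeriv, mvfderiv_fun_smul hf hg]
  rfl

/-- The vector field in coordinates whose divergence is the coefficient of `d(fβ)`. -/
def rotatedCoeffs (c : M) (f : M → ℝ) (β : Π y : M, TangentSpace (𝓡∂ 2) y →ₗ[ℝ] ℂ) :
    Fin 2 → EuclideanSpace ℝ (Fin 2) → ℂ :=
  ![(fun y ↦ f y • oneFormCoeff c β 1 y) ∘ (extChartAt (𝓡∂ 2) c).symm,
    (fun y ↦ f y • -oneFormCoeff c β 0 y) ∘ (extChartAt (𝓡∂ 2) c).symm]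

theorem contDiffOn_rotatedCoeffs (hf : ContMDiff (𝓡∂ 2) 𝓘(ℝ, ℝ) ∞ f) (hβ : IsSmoothOneForm β)
    (c : M) (i : Fin 2) :
    ContDiffOn ℝ ∞ (rotatedCoeffs c f β i) (extChartAt (𝓡∂ 2) c).target := by
  intro p hp
  have hy := (extChartAt (𝓡∂ 2) c).map_target hp
  have hbridge : ∀ {g : M → ℂ}, ContMDiffAt (𝓡∂ 2) 𝓘(ℝ, ℂ) ∞ g ((extChartAt (𝓡∂ 2) c).symm p) →
      ContDiffWithinAt ℝ ∞ (g ∘ (extChartAt (𝓡∂ 2) c).symm) (extChartAt (𝓡∂ 2) c).target p :=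
    fun hg ↦ by
      have := (contMDiffAt_iff_contDiffWithinAt_comp_extChartAt_symm hy).1 hg
      rw [(extChartAt (𝓡∂ 2) c).right_inv hp] at this
      exact this.mono (extChartAt_target_subset_range c)
  fin_cases i
  · exact hbridge ((hf _).smul (hβ c 1 _ hy))
  · exact hbridge ((hf _).smul (hβ c 0 _ hy).neg)

theorem rotatedCoeffs_eq_zero {p : EuclideanSpace ℝ (Fin 2)}
    (hp : f ((extChartAt (𝓡∂ 2) c).symm p) = 0) (i : Fin 2) : rotatedCoeffs c f β i p = 0 := by
  fin_cases i
  · exact smul_eq_zero_of_left hp _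
  · exact smul_eq_zero_of_left hp _

theorem halfSpaceDivergence_rotatedCoeffs (hα : IsExteriorDeriv α β)
    (hf : ContMDiff (𝓡∂ 2) 𝓘(ℝ, ℝ) ∞ f) (hβ : IsSmoothOneForm β) {p : EuclideanSpace ℝ (Fin 2)}
    (hp : p ∈ (extChartAt (𝓡∂ 2) c).target) :
    halfSpaceDivergence (rotatedCoeffs c f β) p =
      chartCoeff c (fun y X Y ↦ (f y : ℂ) * α y X Y) p +
        chartCoeff c (fun y X Y ↦ dWedge f β y X Y) p := by
  obtain ⟨y, hy, rfl⟩ : ∃ y ∈ (extChartAt (𝓡∂ 2) c).source, extChartAt (𝓡∂ 2) c y = p :=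
    ⟨_, (extChartAt (𝓡∂ 2) c).map_target hp, (extChartAt (𝓡∂ 2) c).right_inv hp⟩
  have hfd := (hf y).mdifferentiableAt (by simp)
  have hβd := fun k ↦ (hβ c k y hy).mdifferentiableAt (by simp)
  have hneg : coordDeriv (𝓡∂ 2) c (EuclideanSpace.single 1 1) (fun z ↦ -oneFormCoeff c β 0 z) y =
      -coordDeriv (𝓡∂ 2) c (EuclideanSpace.single 1 1) (oneFormCoeff c β 0) y := by
    simp only [coordDeriv, mvfderiv_fun_neg, neg_apply]
  rw [halfSpaceDivergence, Fin.sum_univ_two, chartCoeff_eq_coordCoeff hp,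
    chartCoeff_eq_coordCoeff hp, (extChartAt (𝓡∂ 2) c).left_inv hy]
  refine (congrArg₂ (· + ·) (mvfderiv_coordField hy (hfd.smul (hβd 1)))
    (mvfderiv_coordField hy (hfd.smul (hβd 0).neg))).symm.trans ?_
  change coordDeriv (𝓡∂ 2) c _ (fun z ↦ f z • oneFormCoeff c β 1 z) y +
    coordDeriv (𝓡∂ 2) c _ (fun z ↦ f z • -oneFormCoeff c β 0 z) y =
    f y * coordCoeff c α y + coordCoeff c (fun z X Y ↦ dWedge f β z X Y) y
  rw [coordDeriv_smul hfd (hβd 1),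
    coordDeriv_smul (g := fun z ↦ -oneFormCoeff c β 0 z) hfd (hβd 0).neg, hneg, hα c y hy,
    coordCoeff, dWedge_apply]
  simp only [coordDeriv, oneFormCoeff, Complex.real_smul]
  ring

theorem rotatedCoeffs_zero_eq_zero_of_boundary
    (hb : ∀ x ∈ (𝓡∂ 2).boundary M, ∀ X ∈ boundaryTangent x, β x X = 0)
    {p : EuclideanSpace ℝ (Fin 2)} (hp : p ∈ (extChartAt (𝓡∂ 2) c).target) (hp₀ : p 0 = 0) :
    rotatedCoeffs c f β 0 p = 0 := by
  have hy := (extChartAt (𝓡∂ 2) c).map_target hp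
  have hyb : (extChartAt (𝓡∂ 2) c).symm p ∈ (𝓡∂ 2).boundary M := by
    rwa [mem_boundary_iff_extChartAt hy, (extChartAt (𝓡∂ 2) c).right_inv hp]
  exact smul_eq_zero_of_right _
    (hb _ hyb _ (coordField_mem_boundaryTangent hy hyb (v := EuclideanSpace.single 1 1) (by simp)))

theorem integral_chartCoeff_mul_eq_neg_integral_chartCoeff_dWedge [T2Space M]
    (hα : IsExteriorDeriv α β) (hf : ContMDiff (𝓡∂ 2) 𝓘(ℝ, ℝ) ∞ f) (hfK : HasCompactSupport f)
    (hfc : tsupport f ⊆ (extChartAt (𝓡∂ 2) c).source) (hβ : IsSmoothOneForm β)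
    (hb : ∀ x ∈ (𝓡∂ 2).boundary M, ∀ X ∈ boundaryTangent x, β x X = 0) :
    ∫ p in (extChartAt (𝓡∂ 2) c).target, chartCoeff c (fun y X Y ↦ (f y : ℂ) * α y X Y) p =
      -∫ p in (extChartAt (𝓡∂ 2) c).target, chartCoeff c (fun y X Y ↦ dWedge f β y X Y) p := by
  have hdiv := integral_halfSpaceDivergence_eq_zero_of_support_subset
    (measurableSet_extChartAt_target c) (extChartAt_target_subset_range c)
    (fun p hp ↦ extChartAt_target_mem_nhdsWithin_of_mem hp)
    (hfK.isCompact.image_of_continuousOn ((continuousOn_extChartAt c).mono hfc))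
    (((extChartAt (𝓡∂ 2) c).mapsTo.mono_left hfc).image_subset)
    (fun i ↦ (contDiffOn_rotatedCoeffs hf hβ c i).of_le (by simp))
    (fun i p hp ↦ rotatedCoeffs_eq_zero (image_eq_zero_of_notMem_tsupport fun h ↦
      hp.2 ⟨_, h, (extChartAt (𝓡∂ 2) c).right_inv hp.1⟩) i)
    (fun p hp hp₀ ↦ rotatedCoeffs_zero_eq_zero_of_boundary hb hp hp₀)
  rw [setIntegral_congr_fun (measurableSet_extChartAt_target c) fun p hp ↦
    halfSpaceDivergence_rotatedCoeffs hα hf hβ hp, integral_add] at hdiv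
  · exact eq_neg_of_add_eq_zero_left hdiv
  · refine integrableOn_chartCoeff hfK.isCompact hfc ?_ fun y hy ↦ ?_
    · exact (Complex.continuous_ofReal.comp hf.continuous).continuousOn.mul
        (hα.hasContinuousCoeffs hβ c)
    · ext X Y
      simp [image_eq_zero_of_notMem_tsupport hy]
  · refine integrableOn_chartCoeff hfK.isCompact hfc (hasContinuousCoeffs_dWedge hf hβ c)
      fun y hy ↦ ?_
    rw [dWedge_eq_zero_of_notMem_tsupport hy]
    rfl

end Stokes

theorem surfaceIntegral_eq_zero_of_isExteriorDeriv {M : Type*} [TopologicalSpace M]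
    [ChartedSpace (EuclideanHalfSpace 2) M] [T2Space M] [CompactSpace M] [IsRiemannSurface M]
    {α : Π y : M, TangentSpace (𝓡∂ 2) y → TangentSpace (𝓡∂ 2) y → ℂ}
    {β : Π y : M, TangentSpace (𝓡∂ 2) y →ₗ[ℝ] ℂ} (hα : IsExteriorDeriv α β) (hβ : IsSmoothOneForm β)
    (hb : ∀ x ∈ (𝓡∂ 2).boundary M, ∀ X ∈ boundaryTangent x, β x X = 0) :
    surfaceIntegral α = 0 := by
  obtain ⟨S, hS, hS₁⟩ := exists_finset_chartPartition (M := M)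
  have hρ : ∀ c, ContMDiff (𝓡∂ 2) 𝓘(ℝ, ℝ) ∞ (chartPartition (M := M) c) := fun c ↦
    (chartPartition (M := M) c).contMDiff
  have hdWedge := fun c ↦ hasContinuousCoeffs_dWedge (hρ c) hβ
  have hlocal : ∀ c, ∫ p in (extChartAt (𝓡∂ 2) c).target,
      chartCoeff c (fun y X Y ↦ (chartPartition (M := M) c y : ℂ) * α y X Y) p =
      -surfaceIntegral (fun y X Y ↦ dWedge (chartPartition (M := M) c) β y X Y) := fun c ↦ by
    have hK := (isClosed_tsupport (chartPartition (M := M) c)).isCompact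
    rw [surfaceIntegral_eq_integral_chartCoeff hK (tsupport_chartPartition_subset c) _
      (isAlt_dWedge _ β) (hdWedge c c) fun y hy ↦ dWedge_eq_zero_of_notMem_tsupport hy]
    exact integral_chartCoeff_mul_eq_neg_integral_chartCoeff_dWedge hα (hρ c) hK
      (tsupport_chartPartition_subset c) hβ hb
  calc surfaceIntegral α
      = -∑ c ∈ S, surfaceIntegral (fun y X Y ↦ dWedge (chartPartition (M := M) c) β y X Y) := by
        rw [surfaceIntegral_eq_sum hS, Finset.sum_congr rfl fun c _ ↦ hlocal c,
          Finset.sum_neg_distrib]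
    _ = 0 := by
        rw [← surfaceIntegral_finset_sum S fun c _ ↦ hdWedge c]
        simp only [sum_dWedge_eq_zero S (fun c _ ↦ (hρ c).mdifferentiableAt (by simp)) hS₁,
          surfaceIntegral, mul_zero, integral_zero, finsum_zero, neg_zero]

section Trivialization

variable {E : Type*} [NormedAddCommGroup E] [NormedSpace ℝ E] {H : Type*} [TopologicalSpace H]
  {I : ModelWithCorners ℝ E H} {M : Type*} [TopologicalSpace M] [ChartedSpace H M]
  {F : Type*} [NormedAddCommGroup F] [NormedSpace ℝ F]
  {V : M → Type*} [TopologicalSpace (TotalSpace F V)]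
  [∀ x, AddCommGroup (V x)] [∀ x, Module ℝ (V x)] [∀ x, TopologicalSpace (V x)]
  [FiberBundle F V] [VectorBundle ℝ F V]
  {e : Trivialization F (TotalSpace.proj : TotalSpace F V → M)} [MemTrivializationAtlas e] {y : M}

theorem continuousLinearMapAt_eventuallyEq (hy : y ∈ e.baseSet) (σ : Π z, V z) :
    (fun z ↦ e.continuousLinearMapAt ℝ z (σ z)) =ᶠ[𝓝 y] fun z ↦ (e ⟨z, σ z⟩).2 := by
  filter_upwards [e.open_baseSet.mem_nhds hy] with z hz
  exact e.continuousLinearMapAt_apply_of_mem ℝ hz _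

theorem trace_eq_trace_of_continuousLinearMapAt (hy : y ∈ e.baseSet) {T : V y →ₗ[ℝ] V y}
    {S : F →ₗ[ℝ] F}
    (h : ∀ w, e.continuousLinearMapAt ℝ y (T w) = S (e.continuousLinearMapAt ℝ y w)) :
    LinearMap.trace ℝ (V y) T = LinearMap.trace ℝ F S := by
  rw [← LinearMap.trace_conj' T (e.continuousLinearEquivAt ℝ y hy).toLinearEquiv]
  congr 1
  ext v
  have hv := h (e.symmL ℝ y v)
  rw [e.continuousLinearMapAt_symmL hy, e.continuousLinearMapAt_apply_of_mem ℝ hy,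
    ← e.symm_continuousLinearEquivAt_eq hy] at hv
  exact hv

theorem exists_contMDiff_section_eventuallyEq [IsManifold I ∞ M] [FiniteDimensional ℝ E] [T2Space M]
    {U : Set M} (hU : U ∈ 𝓝 y) {σ : Π z, V z} (hσ : ContMDiffOn I (I.prod 𝓘(ℝ, F)) ∞ (T% σ) U) :
    ∃ τ : Π z, V z, ContMDiff I (I.prod 𝓘(ℝ, F)) ∞ (T% τ) ∧ ∀ᶠ z in 𝓝 y, σ z = τ z := by
  obtain ⟨U', hU'U, hU', hy⟩ := mem_nhds_iff.1 hU
  obtain ⟨f, -, hf⟩ := (SmoothBumpFunction.nhds_basis_tsupport (I := I) y).mem_iff.1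
    (hU'.mem_nhds hy)
  refine ⟨(f : M → ℝ) • σ,
    ContMDiffOn.smul_section_of_tsupport f.contMDiff.contMDiffOn hU' hf (hσ.mono hU'U), ?_⟩
  filter_upwards [f.eventuallyEq_one] with z hz
  simp [hz]

section CovSum

variable [∀ x, IsTopologicalAddGroup (V x)] [∀ x, ContinuousSMul ℝ (V x)]

theorem cov_sum_smul (D : CovariantDerivative I F V) {ι : Type*} (s : Finset ι) {f : ι → M → ℝ}
    {σ : ι → Π z, V z} (hf : ∀ i, MDifferentiableAt I 𝓘(ℝ, ℝ) (f i) y)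
    (hσ : ∀ i, MDifferentiableAt I (I.prod 𝓘(ℝ, F)) (T% (σ i)) y) (X : TangentSpace I y) :
    D (fun z ↦ ∑ i ∈ s, f i z • σ i z) y X =
      ∑ i ∈ s, (f i y • D (σ i) y X + mvfderiv I (f i) y X • σ i y) := by
  classical
  have hfσ := fun i ↦ (hf i).smul_section (hσ i)
  induction s using Finset.induction_on with
  | empty =>
    simp only [Finset.sum_empty]
    exact congr($D.zero y X)
  | insert i s hi ih =>
    have hadd := D.isCovariantDerivativeOnUniv.add (hfσ i)
      (MDifferentiableAt.sum_section (s := s) fun j _ ↦ hfσ j)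
    simp only [Finset.sum_insert hi, ← ih]
    refine congr($hadd X).trans ?_
    rw [add_apply, D.isCovariantDerivativeOnUniv.leibniz (hσ i) (hf i)]
    rfl

end CovSum

theorem contMDiffAt_clm_of_basis [FiniteDimensional ℝ F] {n : ℕ}
    (b : Module.Basis (Fin n) ℝ F) {S : M → F →L[ℝ] F}
    (hS : ∀ i, ContMDiffAt I 𝓘(ℝ, F) ∞ (fun z ↦ S z (b i)) y) :
    ContMDiffAt I 𝓘(ℝ, F →L[ℝ] F) ∞ S y := by
  let ofColumns : (Fin n → F) →L[ℝ] F →L[ℝ] F :=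
    (LinearMap.toContinuousLinearMap.toLinearMap ∘ₗ (b.constr ℝ).toLinearMap).toContinuousLinearMap
  have hcolumns : S = fun z ↦ ofColumns fun i ↦ S z (b i) := by
    funext z
    exact ContinuousLinearMap.coe_injective (b.constr_self (S := ℝ) (S z : F →ₗ[ℝ] F)).symm
  rw [hcolumns]
  exact ofColumns.contMDiff.contMDiffAt.comp y (contMDiffAt_pi_space.2 hS)

variable [ContMDiffVectorBundle ∞ F V I]

theorem contMDiffAt_section_iff_continuousLinearMapAt (hy : y ∈ e.baseSet) {σ : Π z, V z} :
    ContMDiffAt I (I.prod 𝓘(ℝ, F)) ∞ (T% σ) y ↔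
      ContMDiffAt I 𝓘(ℝ, F) ∞ (fun z ↦ e.continuousLinearMapAt ℝ z (σ z)) y :=
  (e.contMDiffAt_section_iff hy).trans
    (continuousLinearMapAt_eventuallyEq hy σ).contMDiffAt_iff.symm

theorem mdifferentiableAt_section_iff_continuousLinearMapAt (hy : y ∈ e.baseSet) {σ : Π z, V z} :
    MDifferentiableAt I (I.prod 𝓘(ℝ, F)) (T% σ) y ↔
      MDifferentiableAt I 𝓘(ℝ, F) (fun z ↦ e.continuousLinearMapAt ℝ z (σ z)) y :=
  (e.mdifferentiableAt_section_iff I σ hy).trans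
    (continuousLinearMapAt_eventuallyEq hy σ).mdifferentiableAt_iff.symm

theorem mdifferentiableAt_symmL (hy : y ∈ e.baseSet) (v : F) :
    MDifferentiableAt I (I.prod 𝓘(ℝ, F)) (T% fun z ↦ e.symmL ℝ z v) y :=
  ((contMDiffOn_symmL e v).contMDiffAt (e.open_baseSet.mem_nhds hy)).mdifferentiableAt
    (n := ∞) (by simp)

variable [IsManifold I ∞ M] [∀ x, IsTopologicalAddGroup (V x)] [∀ x, ContinuousSMul ℝ (V x)]
  [FiniteDimensional ℝ F]

variable (e) in
/-- The matrix of the connection form of `D` in the trivialization `e`, evaluated on the tangent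
vector `X`. -/
def connectionMatrix (D : CovariantDerivative I F V) (y : M) (X : TangentSpace I y) : F →L[ℝ] F :=
  ((Module.finBasis ℝ F).constr ℝ fun i ↦ e.continuousLinearMapAt ℝ y
    (D (fun z ↦ e.symmL ℝ z (Module.finBasis ℝ F i)) y X)).toContinuousLinearMap

theorem continuousLinearMapAt_cov (D : CovariantDerivative I F V) (hy : y ∈ e.baseSet)
    {σ : Π z, V z} (hσ : MDifferentiableAt I (I.prod 𝓘(ℝ, F)) (T% σ) y) (X : TangentSpace I y) :
    e.continuousLinearMapAt ℝ y (D σ y X) =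
      mvfderiv I (fun z ↦ e.continuousLinearMapAt ℝ z (σ z)) y X +
        connectionMatrix e D y X (e.continuousLinearMapAt ℝ y (σ y)) := by
  set b := Module.finBasis ℝ F
  have hf := (mdifferentiableAt_section_iff_continuousLinearMapAt hy).1 hσ
  have hcoord := fun i ↦ (b.coord i).toContinuousLinearMap.mdifferentiableAt.comp y hf
  have hexpand : ∀ᶠ z in 𝓝 y,
      σ z = ∑ i, b.coord i (e.continuousLinearMapAt ℝ z (σ z)) • e.symmL ℝ z (b i) := by
    filter_upwards [e.open_baseSet.mem_nhds hy] with z hz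
    simp only [← map_smul, ← map_sum, Module.Basis.coord_apply, b.sum_repr]
    exact (e.symmL_continuousLinearMapAt hz _).symm
  rw [D.isCovariantDerivativeOnUniv.congr_of_eventuallyEq hσ (MDifferentiableAt.sum_section
      fun i _ ↦ (hcoord i).smul_section (mdifferentiableAt_symmL hy (b i))) Filter.univ_mem hexpand]
  refine (congrArg _ (cov_sum_smul D Finset.univ hcoord
    (fun i ↦ mdifferentiableAt_symmL hy (b i)) X)).trans ?_
  have hderiv : ∀ i, mvfderiv I ((b.coord i).toContinuousLinearMap ∘
      fun z ↦ e.continuousLinearMapAt ℝ z (σ z)) y X =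
      b.repr (mvfderiv I (fun z ↦ e.continuousLinearMapAt ℝ z (σ z)) y X) i := fun i ↦
    mvfderiv_clm_comp (b.coord i).toContinuousLinearMap hf X
  simp only [hderiv, map_sum, map_add, map_smul, e.continuousLinearMapAt_symmL hy,
    Finset.sum_add_distrib, b.sum_repr]
  rw [add_comm, connectionMatrix, LinearMap.coe_toContinuousLinearMap',
    Module.Basis.constr_apply_fintype]
  rfl

theorem connectionMatrix_apply (D : CovariantDerivative I F V) (hy : y ∈ e.baseSet)
    (X : TangentSpace I y) (v : F) :
    connectionMatrix e D y X v =
      e.continuousLinearMapAt ℝ y (D (fun z ↦ e.symmL ℝ z v) y X) := by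
  have hconst : (fun z ↦ e.continuousLinearMapAt ℝ z (e.symmL ℝ z v)) =ᶠ[𝓝 y] fun _ ↦ v := by
    filter_upwards [e.open_baseSet.mem_nhds hy] with z hz
    exact e.continuousLinearMapAt_symmL hz v
  rw [continuousLinearMapAt_cov D hy (mdifferentiableAt_symmL hy v), mvfderiv_congr hconst,
    mvfderiv_const, zero_apply, zero_add, e.continuousLinearMapAt_symmL hy]

end Trivialization

section Curvature

variable {M : Type*} [TopologicalSpace M] [ChartedSpace (EuclideanHalfSpace 2) M]
  {F : Type*} [NormedAddCommGroup F] [NormedSpace ℝ F]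
  {V : M → Type*} [TopologicalSpace (TotalSpace F V)]
  [∀ x, AddCommGroup (V x)] [∀ x, Module ℝ (V x)] [∀ x, TopologicalSpace (V x)]
  [∀ x, IsTopologicalAddGroup (V x)] [∀ x, ContinuousSMul ℝ (V x)]
  [FiberBundle F V]

theorem curvatureAux_swap (D : CovariantDerivative (𝓡∂ 2) F V)
    (X Y : Π x : M, TangentSpace (𝓡∂ 2) x) (σ : Π x, V x) (y : M) :
    curvatureAux D X Y σ y = -curvatureAux D Y X σ y := by
  rw [curvatureAux, curvatureAux, VectorField.mlieBracket_swap_apply, map_neg]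
  abel

variable [IsManifold (𝓡∂ 2) ∞ M] [VectorBundle ℝ F V] [T2Space M]
  {e : Trivialization F (TotalSpace.proj : TotalSpace F V → M)} [MemTrivializationAtlas e]
  (D : SmoothConnection F V) {c y : M}

theorem contMDiffAt_cov {U : Set M} (hU : U ∈ 𝓝 y) {σ : Π z, V z}
    (hσ : ContMDiffOn (𝓡∂ 2) ((𝓡∂ 2).prod 𝓘(ℝ, F)) ∞ (T% σ) U)
    {Y : Π z : M, TangentSpace (𝓡∂ 2) z}
    (hY : ContMDiffAt (𝓡∂ 2) ((𝓡∂ 2).prod 𝓘(ℝ, EuclideanSpace ℝ (Fin 2))) ∞ (T% Y) y) :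
    ContMDiffAt (𝓡∂ 2) ((𝓡∂ 2).prod 𝓘(ℝ, F)) ∞ (T% fun z ↦ D.cov σ z (Y z)) y := by
  obtain ⟨τ, hτ, hστ⟩ := exists_contMDiff_section_eventuallyEq hU hσ
  have hcovτ := (D.smooth.contMDiff.contMDiff (σ := τ) (by simpa using hτ.contMDiffOn)).contMDiffAt
    (x := y) Filter.univ_mem
  refine (hcovτ.clm_bundle_apply hY).congr_of_eventuallyEq ?_
  filter_upwards [hστ.eventually_nhds, eventually_mem_nhds_iff.2 hU] with z hστz hUz
  simp [D.cov.isCovariantDerivativeOn.congr_of_eventuallyEq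
    ((hσ.contMDiffAt hUz).mdifferentiableAt (by simp))
    ((hτ z).mdifferentiableAt (by simp)) Filter.univ_mem hστz]

variable [ContMDiffVectorBundle ∞ F V (𝓡∂ 2)] [FiniteDimensional ℝ F]

theorem tensorialAt_curvatureAux (X : Π x : M, TangentSpace (𝓡∂ 2) x) (w : V y) :
    TensorialAt (𝓡∂ 2) (EuclideanSpace ℝ (Fin 2))
      (fun Y ↦ curvatureAux D.cov X Y (FiberBundle.extend F w) y) y where
  smul {f Y} hf hY := by
    have hpull : (fun z ↦ D.cov (FiberBundle.extend F w) z ((f • Y) z)) =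
        f • fun z ↦ D.cov (FiberBundle.extend F w) z (Y z) :=
      funext fun z ↦ map_smul (D.cov (FiberBundle.extend F w) z) (f z) (Y z)
    unfold curvatureAux
    rw [hpull, D.cov.isCovariantDerivativeOnUniv.leibniz
      (mdifferentiableAt_cov_extend D.cov D.smooth w hY) hf,
      VectorField.mlieBracket_smul_right hf hY]
    simp only [Pi.smul_apply', map_smul, map_add, add_apply, smul_apply,
      ContinuousLinearMap.smulRight_apply]
    module
  add {Y Y'} hY hY' := by
    have hpull : (fun z ↦ D.cov (FiberBundle.extend F w) z ((Y + Y') z)) =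
        (fun z ↦ D.cov (FiberBundle.extend F w) z (Y z)) +
          fun z ↦ D.cov (FiberBundle.extend F w) z (Y' z) :=
      funext fun z ↦ map_add (D.cov (FiberBundle.extend F w) z) (Y z) (Y' z)
    unfold curvatureAux
    rw [hpull, D.cov.isCovariantDerivativeOnUniv.add
      (mdifferentiableAt_cov_extend D.cov D.smooth w hY)
      (mdifferentiableAt_cov_extend D.cov D.smooth w hY'),
      VectorField.mlieBracket_add_right hY hY']
    simp only [Pi.add_apply, map_add, add_apply]
    abel

theorem curvature_apply {X Y : Π x : M, TangentSpace (𝓡∂ 2) x}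
    (hX : MDifferentiableAt (𝓡∂ 2) ((𝓡∂ 2).prod 𝓘(ℝ, EuclideanSpace ℝ (Fin 2))) (T% X) y)
    (hY : MDifferentiableAt (𝓡∂ 2) ((𝓡∂ 2).prod 𝓘(ℝ, EuclideanSpace ℝ (Fin 2))) (T% Y) y)
    (w : V y) :
    D.curvature y (X y) (Y y) w = curvatureAux D.cov X Y (FiberBundle.extend F w) y := by
  have hextend (Z : TangentSpace (𝓡∂ 2) y) := FiberBundle.mdifferentiableAt_extend (𝓡∂ 2)
    (EuclideanSpace ℝ (Fin 2)) (V := fun y : M ↦ TangentSpace (𝓡∂ 2) y) Z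
  have hself (Z : TangentSpace (𝓡∂ 2) y) :
      FiberBundle.extend (EuclideanSpace ℝ (Fin 2))
        (E := fun y : M ↦ TangentSpace (𝓡∂ 2) y) Z y = Z :=
    FiberBundle.extend_apply_self _ _
  change curvatureAux D.cov (FiberBundle.extend (EuclideanSpace ℝ (Fin 2)) (X y))
    (FiberBundle.extend (EuclideanSpace ℝ (Fin 2)) (Y y)) (FiberBundle.extend F w) y = _
  rw [(tensorialAt_curvatureAux D _ w).pointwise (hextend _) hY (hself _), curvatureAux_swap,
    (tensorialAt_curvatureAux D _ w).pointwise (hextend _) hX (hself _), ← curvatureAux_swap]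

variable (e c) in
/-- The matrix of the connection form of `D` in the trivialization `e`, evaluated on the coordinate
field of direction `v` of the chart at `c`. -/
def connectionCoeff (v : EuclideanSpace ℝ (Fin 2)) (y : M) : F →L[ℝ] F :=
  connectionMatrix e D.cov y (coordField (𝓡∂ 2) c v y)

variable (hc : y ∈ (extChartAt (𝓡∂ 2) c).source) (he : y ∈ e.baseSet)
  {v w : EuclideanSpace ℝ (Fin 2)}

include hc he

theorem contMDiffAt_connectionCoeff :
    ContMDiffAt (𝓡∂ 2) 𝓘(ℝ, F →L[ℝ] F) ∞ (connectionCoeff e D c v) y := by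
  refine contMDiffAt_clm_of_basis (Module.finBasis ℝ F) fun i ↦ ?_
  have hcolumn := (contMDiffAt_section_iff_continuousLinearMapAt he).1 <|
    contMDiffAt_cov D (e.open_baseSet.mem_nhds he) (contMDiffOn_symmL e (Module.finBasis ℝ F i))
      (contMDiffAt_coordField v hc)
  refine hcolumn.congr_of_eventuallyEq ?_
  filter_upwards [e.open_baseSet.mem_nhds he] with z hz
  exact connectionMatrix_apply D.cov hz _ _

theorem continuousLinearMapAt_cov_cov {U : Set M} (hU : U ∈ 𝓝 y) {σ : Π z, V z}
    (hσ : ContMDiffOn (𝓡∂ 2) ((𝓡∂ 2).prod 𝓘(ℝ, F)) ∞ (T% σ) U) {f : M → F}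
    (hf : f = fun z ↦ e.continuousLinearMapAt ℝ z (σ z)) :
    e.continuousLinearMapAt ℝ y (D.cov (fun z ↦ D.cov σ z (coordField (𝓡∂ 2) c w z)) y
        (coordField (𝓡∂ 2) c v y)) =
      coordDeriv (𝓡∂ 2) c v (coordDeriv (𝓡∂ 2) c w f) y +
        (connectionCoeff e D c w y (coordDeriv (𝓡∂ 2) c v f y) +
          coordDeriv (𝓡∂ 2) c v (connectionCoeff e D c w) y (f y)) +
        connectionCoeff e D c v y
          (coordDeriv (𝓡∂ 2) c w f y + connectionCoeff e D c w y (f y)) := by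
  have hfy : ContMDiffAt (𝓡∂ 2) 𝓘(ℝ, F) ∞ f y := hf ▸
    (contMDiffAt_section_iff_continuousLinearMapAt he).1 (hσ.contMDiffAt hU)
  have hcovσ := contMDiffAt_cov D hU hσ (contMDiffAt_coordField w hc)
  have hlocal : (fun z ↦ e.continuousLinearMapAt ℝ z (D.cov σ z (coordField (𝓡∂ 2) c w z))) =ᶠ[𝓝 y]
      fun z ↦ coordDeriv (𝓡∂ 2) c w f z + connectionCoeff e D c w z (f z) := by
    filter_upwards [e.open_baseSet.mem_nhds he, eventually_mem_nhds_iff.2 hU] with z hez hUz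
    subst hf
    exact continuousLinearMapAt_cov D.cov hez
      ((hσ.contMDiffAt hUz).mdifferentiableAt (by simp)) _
  have hΓ := (contMDiffAt_connectionCoeff D hc he (v := w)).mdifferentiableAt (by simp)
  have hf' := hfy.mdifferentiableAt (by simp)
  rw [continuousLinearMapAt_cov D.cov he (hcovσ.mdifferentiableAt (by simp)), hlocal.eq_of_nhds,
    mvfderiv_congr hlocal, mvfderiv_fun_add ((contMDiffAt_coordDeriv hc hfy).mdifferentiableAt
      (by simp)) (hΓ.clm_apply hf'), add_apply]
  congr 2
  exact mvfderiv_bilinear (ContinuousLinearMap.id ℝ (F →L[ℝ] F)) hΓ hf' _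

omit hc he in
variable (e c v w) in
/-- The matrix, in the trivialization `e`, of the curvature of `D` evaluated on the coordinate
fields of directions `v` and `w` of the chart at `c`: `∂ᵥ Γ_w - ∂_w Γᵥ + [Γᵥ, Γ_w]`. -/
def curvatureMatrix (y : M) : F →L[ℝ] F :=
  coordDeriv (𝓡∂ 2) c v (connectionCoeff e D c w) y -
      coordDeriv (𝓡∂ 2) c w (connectionCoeff e D c v) y +
    (connectionCoeff e D c v y * connectionCoeff e D c w y -
      connectionCoeff e D c w y * connectionCoeff e D c v y)

theorem continuousLinearMapAt_curvature (u : V y) :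
    e.continuousLinearMapAt ℝ y
        (D.curvature y (coordField (𝓡∂ 2) c v y) (coordField (𝓡∂ 2) c w y) u) =
      curvatureMatrix e D c v w y (e.continuousLinearMapAt ℝ y u) := by
  have hcoord (v) := (contMDiffAt_coordField v hc).mdifferentiableAt (n := ∞) (by simp)
  obtain ⟨U, hU, hu⟩ := FiberBundle.exists_contMDiffOn_extend (k := ∞) (𝓡∂ 2) F u
  have hf := (contMDiffAt_section_iff_continuousLinearMapAt he).1 (hu.contMDiffAt hU)
  rw [curvature_apply D (hcoord v) (hcoord w), curvatureAux, mlieBracket_coordField hc, map_zero,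
    sub_zero, map_sub, continuousLinearMapAt_cov_cov D hc he hU hu rfl,
    continuousLinearMapAt_cov_cov D hc he hU hu rfl, coordDeriv_comm hc hf,
    FiberBundle.extend_apply_self, curvatureMatrix]
  simp only [add_apply, sub_apply, mul_apply_eq_comp, map_add]
  abel

theorem contMDiffAt_curvatureMatrix :
    ContMDiffAt (𝓡∂ 2) 𝓘(ℝ, F →L[ℝ] F) ∞ (curvatureMatrix e D c v w) y := by
  have hΓ (u) := contMDiffAt_connectionCoeff D hc he (v := u)
  exact ((contMDiffAt_coordDeriv hc (hΓ w)).sub (contMDiffAt_coordDeriv hc (hΓ v))).add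
    (((hΓ v).clm_comp (hΓ w)).sub ((hΓ w).clm_comp (hΓ v)))

end Curvature

section ComplexTrace

variable {W : Type*} [AddCommGroup W] [Module ℝ W]

theorem complexTrace_commutator_of_comp_comm {J A : W →ₗ[ℝ] W} (hA : J ∘ₗ A = A ∘ₗ J)
    (B : W →ₗ[ℝ] W) : complexTrace J (A * B - B * A) = 0 := by
  have hJA : J * (A * B - B * A) = A * (J * B) - J * B * A := by
    rw [mul_sub, ← mul_assoc, ← mul_assoc, ← mul_assoc, show J * A = A * J from hA]
  rw [complexTrace, ← Module.End.mul_eq_comp, hJA, map_sub, map_sub, LinearMap.trace_mul_comm,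
    LinearMap.trace_mul_comm ℝ A (J * B)]
  simp

/-- The linear map `complexTrace J`. -/
def complexTraceₗ (J : W →ₗ[ℝ] W) : (W →ₗ[ℝ] W) →ₗ[ℝ] ℂ where
  toFun := complexTrace J
  map_add' S T := by
    simp only [complexTrace, LinearMap.comp_add, map_add, Complex.ofReal_add]
    ring
  map_smul' a S := by
    simp only [complexTrace, LinearMap.comp_smul, map_smul, smul_eq_mul, Complex.ofReal_mul,
      RingHom.id_apply, Complex.real_smul]
    ring

theorem complexTrace_add (J S T : W →ₗ[ℝ] W) :
    complexTrace J (S + T) = complexTrace J S + complexTrace J T :=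
  map_add (complexTraceₗ J) S T

theorem complexTrace_sub (J S T : W →ₗ[ℝ] W) :
    complexTrace J (S - T) = complexTrace J S - complexTrace J T :=
  map_sub (complexTraceₗ J) S T

end ComplexTrace

section ComplexTraceDerivative

variable {E : Type*} [NormedAddCommGroup E] [NormedSpace ℝ E] {H : Type*} [TopologicalSpace H]
  {I : ModelWithCorners ℝ E H} {M : Type*} [TopologicalSpace M] [ChartedSpace H M]
  {F : Type*} [NormedAddCommGroup F] [NormedSpace ℝ F] [FiniteDimensional ℝ F]
  {J S : M → F →L[ℝ] F} {y : M}

variable (F) in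
/-- The trace of continuous endomorphisms, as a continuous linear form. -/
def traceL : (F →L[ℝ] F) →L[ℝ] ℝ :=
  (LinearMap.trace ℝ F ∘ₗ ContinuousLinearMap.coeLM ℝ).toContinuousLinearMap

theorem complexTrace_eq_traceL (J S : F →L[ℝ] F) :
    complexTrace (J : F →ₗ[ℝ] F) S =
      (1 / 2 : ℂ) • Complex.ofRealCLM (traceL F S) +
        (-Complex.I / 2) • Complex.ofRealCLM (traceL F (J * S)) := by
  change ((LinearMap.trace ℝ F S : ℂ) - Complex.I * (LinearMap.trace ℝ F (J * S : F →L[ℝ] F) : ℂ))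
    / 2 = (1 / 2) * (LinearMap.trace ℝ F S : ℂ) +
      (-Complex.I / 2) * (LinearMap.trace ℝ F (J * S : F →L[ℝ] F) : ℂ)
  ring

theorem contMDiffAt_complexTrace (hJ : ContMDiffAt I 𝓘(ℝ, F →L[ℝ] F) ∞ J y)
    (hS : ContMDiffAt I 𝓘(ℝ, F →L[ℝ] F) ∞ S y) :
    ContMDiffAt I 𝓘(ℝ, ℂ) ∞ (fun z ↦ complexTrace (J z : F →ₗ[ℝ] F) (S z)) y := by
  let τ := Complex.ofRealCLM ∘L traceL F
  simp only [complexTrace_eq_traceL]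
  exact (((1 / 2 : ℂ) • τ).contMDiff.contMDiffAt.comp y hS).add
    (((-Complex.I / 2) • τ).contMDiff.contMDiffAt.comp y (hJ.clm_comp hS))

/-- If `J` is parallel for the connection with matrix `Γ`, the complex trace is differentiated
covariantly. -/
theorem mvfderiv_complexTrace [IsManifold I ∞ M] (hJ : MDifferentiableAt I 𝓘(ℝ, F →L[ℝ] F) J y)
    (hS : MDifferentiableAt I 𝓘(ℝ, F →L[ℝ] F) S y) {X : TangentSpace I y} {Γ : F →L[ℝ] F}
    (hΓ : mvfderiv I J y X = J y * Γ - Γ * J y) :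
    mvfderiv I (fun z ↦ complexTrace (J z : F →ₗ[ℝ] F) (S z)) y X =
      complexTrace (J y : F →ₗ[ℝ] F)
        (mvfderiv I S y X + (Γ * S y - S y * Γ) : F →L[ℝ] F) := by
  let τ := Complex.ofRealCLM ∘L traceL F
  have hcyclic (A B : F →L[ℝ] F) : traceL F (A * B) = traceL F (B * A) :=
    LinearMap.trace_mul_comm ℝ (A : F →ₗ[ℝ] F) (B : F →ₗ[ℝ] F)
  have hJS : mvfderiv I (fun z ↦ J z * S z) y X =
      J y * mvfderiv I S y X + mvfderiv I J y X * S y :=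
    mvfderiv_bilinear (ContinuousLinearMap.compL ℝ F F F) hJ hS X
  have hJS' : MDifferentiableAt I 𝓘(ℝ, F →L[ℝ] F) (fun z ↦ J z * S z) y := hJ.clm_comp hS
  have htrace : traceL F (mvfderiv I (fun z ↦ J z * S z) y X) =
      traceL F (J y * (mvfderiv I S y X + (Γ * S y - S y * Γ))) := by
    have hsplit : traceL F (J y * (S y * Γ)) = traceL F (Γ * J y * S y) := by
      rw [← mul_assoc, hcyclic, mul_assoc]
    rw [hJS, hΓ, sub_mul, mul_add, mul_sub, map_add, map_add, map_sub, map_sub, hsplit, mul_assoc]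
  have hadd : mvfderiv I (fun z ↦ ((1 / 2 : ℂ) • τ) (S z) + ((-Complex.I / 2) • τ) (J z * S z)) y =
      mvfderiv I (fun z ↦ ((1 / 2 : ℂ) • τ) (S z)) y +
        mvfderiv I (fun z ↦ ((-Complex.I / 2) • τ) (J z * S z)) y :=
    mvfderiv_fun_add (((1 / 2 : ℂ) • τ).mdifferentiableAt.comp y hS)
      (((-Complex.I / 2) • τ).mdifferentiableAt.comp y hJS')
  simp only [complexTrace_eq_traceL]
  refine (congr($hadd X).trans (congrArg₂ (· + ·) (mvfderiv_clm_comp ((1 / 2 : ℂ) • τ) hS X)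
    (mvfderiv_clm_comp ((-Complex.I / 2) • τ) hJS' X))).trans ?_
  rw [← htrace, map_add (traceL F), map_sub (traceL F), hcyclic (S y), sub_self, add_zero]
  rfl

end ComplexTraceDerivative

section TraceForm

variable {M : Type*} [TopologicalSpace M] [ChartedSpace (EuclideanHalfSpace 2) M]
  {F : Type*} [NormedAddCommGroup F] [NormedSpace ℝ F]
  {V : M → Type*} [TopologicalSpace (TotalSpace F V)]
  [∀ x, AddCommGroup (V x)] [∀ x, Module ℝ (V x)] [∀ x, TopologicalSpace (V x)]
  [∀ x, IsTopologicalAddGroup (V x)] [∀ x, ContinuousSMul ℝ (V x)]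
  [FiberBundle F V] [VectorBundle ℝ F V] {y : M}
  {e : Trivialization F (TotalSpace.proj : TotalSpace F V → M)} [MemTrivializationAtlas e]

section ConnectionDifference

variable [ContMDiffVectorBundle ∞ F V (𝓡∂ 2)] [FiniteDimensional ℝ F]
  (D₁ D₂ : CovariantDerivative (𝓡∂ 2) F V)

/-- The `End V`-valued `1`-form `D₁ - D₂`. -/
def connectionDifference (y : M) : TangentSpace (𝓡∂ 2) y →ₗ[ℝ] V y →ₗ[ℝ] V y :=
  LinearMap.mk₂ ℝ (fun X w ↦ CovariantDerivative.difference D₁ D₂ y w X)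
    (by intros; simp) (by intros; simp) (by intros; simp) (by intros; simp)

theorem connectionDifference_apply {σ : Π z, V z}
    (hσ : MDifferentiableAt (𝓡∂ 2) ((𝓡∂ 2).prod 𝓘(ℝ, F)) (T% σ) y) (X : TangentSpace (𝓡∂ 2) y) :
    connectionDifference D₁ D₂ y X (σ y) = D₁ σ y X - D₂ σ y X :=
  congr($(IsCovariantDerivativeOn.difference_apply D₁.isCovariantDerivativeOnUniv
    D₂.isCovariantDerivativeOnUniv (mem_univ y) hσ) X)

theorem connectionDifference_extend (X : TangentSpace (𝓡∂ 2) y) (w : V y) :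
    connectionDifference D₁ D₂ y X w =
      D₁ (FiberBundle.extend F w) y X - D₂ (FiberBundle.extend F w) y X := by
  simpa only [FiberBundle.extend_apply_self] using
    connectionDifference_apply D₁ D₂ (FiberBundle.mdifferentiableAt_extend (𝓡∂ 2) F w) X

theorem continuousLinearMapAt_connectionDifference [IsManifold (𝓡∂ 2) ∞ M]
    (he : y ∈ e.baseSet) (X : TangentSpace (𝓡∂ 2) y) (w : V y) :
    e.continuousLinearMapAt ℝ y (connectionDifference D₁ D₂ y X w) =
      (connectionMatrix e D₁ y X - connectionMatrix e D₂ y X) (e.continuousLinearMapAt ℝ y w) := by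
  rw [sub_apply, connectionMatrix_apply _ he, connectionMatrix_apply _ he, ← map_sub,
    ← connectionDifference_apply _ _ (mdifferentiableAt_symmL he _),
    e.symmL_continuousLinearMapAt he]

end ConnectionDifference

section CurvatureDifference

variable [ContMDiffVectorBundle ∞ F V (𝓡∂ 2)] [FiniteDimensional ℝ F] [IsManifold (𝓡∂ 2) ∞ M]
  (D₁ D₂ : SmoothConnection F V) {c : M} {v w : EuclideanSpace ℝ (Fin 2)}

variable (e c v) in
/-- The matrix, in the trivialization `e`, of the `1`-form `D₁ - D₂` evaluated on the coordinate
field of direction `v` of the chart at `c`. -/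
def differenceCoeff (y : M) : F →L[ℝ] F :=
  connectionCoeff e D₁ c v y - connectionCoeff e D₂ c v y

variable [T2Space M] (hc : y ∈ (extChartAt (𝓡∂ 2) c).source) (he : y ∈ e.baseSet)

include hc he

theorem contMDiffAt_differenceCoeff :
    ContMDiffAt (𝓡∂ 2) 𝓘(ℝ, F →L[ℝ] F) ∞ (differenceCoeff e D₁ D₂ c v) y :=
  (contMDiffAt_connectionCoeff D₁ hc he).sub (contMDiffAt_connectionCoeff D₂ hc he)

theorem coordDeriv_differenceCoeff :
    coordDeriv (𝓡∂ 2) c w (differenceCoeff e D₁ D₂ c v) y =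
      coordDeriv (𝓡∂ 2) c w (connectionCoeff e D₁ c v) y -
        coordDeriv (𝓡∂ 2) c w (connectionCoeff e D₂ c v) y :=
  congr($(mvfderiv_fun_sub ((contMDiffAt_connectionCoeff D₁ hc he).mdifferentiableAt (by simp))
    ((contMDiffAt_connectionCoeff D₂ hc he).mdifferentiableAt (by simp))) _)

/-- `F_{D + A} = F_D + d_D A + A ∧ A`, for `A = D₁ - D₂` and `D = D₂`. -/
theorem curvatureMatrix_sub_curvatureMatrix :
    curvatureMatrix e D₁ c v w y - curvatureMatrix e D₂ c v w y =
      (coordDeriv (𝓡∂ 2) c v (differenceCoeff e D₁ D₂ c w) y +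
          (connectionCoeff e D₂ c v y * differenceCoeff e D₁ D₂ c w y -
            differenceCoeff e D₁ D₂ c w y * connectionCoeff e D₂ c v y)) -
        (coordDeriv (𝓡∂ 2) c w (differenceCoeff e D₁ D₂ c v) y +
          (connectionCoeff e D₂ c w y * differenceCoeff e D₁ D₂ c v y -
            differenceCoeff e D₁ D₂ c v y * connectionCoeff e D₂ c w y)) +
        (differenceCoeff e D₁ D₂ c v y * differenceCoeff e D₁ D₂ c w y -
          differenceCoeff e D₁ D₂ c w y * differenceCoeff e D₁ D₂ c v y) := by
  rw [coordDeriv_differenceCoeff D₁ D₂ hc he, coordDeriv_differenceCoeff D₁ D₂ hc he]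
  simp only [curvatureMatrix, differenceCoeff]
  noncomm_ring

end CurvatureDifference

variable {P : BundlePair F V} {𝒥 : CompatibleComplexStructure P}

variable (e) in
/-- The matrix of the complex structure in the trivialization `e`. -/
def CompatibleComplexStructure.matrix (𝒥 : CompatibleComplexStructure P) (y : M) : F →L[ℝ] F :=
  e.continuousLinearMapAt ℝ y ∘L 𝒥.J y ∘L e.symmL ℝ y

theorem continuousLinearMapAt_complexStructure (he : y ∈ e.baseSet) (w : V y) :
    e.continuousLinearMapAt ℝ y (𝒥.J y w) = 𝒥.matrix e y (e.continuousLinearMapAt ℝ y w) := by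
  simp only [CompatibleComplexStructure.matrix, ContinuousLinearMap.comp_apply,
    e.symmL_continuousLinearMapAt he]

theorem complexTrace_eq_of_continuousLinearMapAt [FiniteDimensional ℝ F] (he : y ∈ e.baseSet)
    {T : V y →ₗ[ℝ] V y} {S : F →L[ℝ] F}
    (h : ∀ w, e.continuousLinearMapAt ℝ y (T w) = S (e.continuousLinearMapAt ℝ y w)) :
    complexTrace (𝒥.J y : V y →ₗ[ℝ] V y) T = complexTrace (𝒥.matrix e y : F →ₗ[ℝ] F) S := by
  rw [complexTrace, trace_eq_trace_of_continuousLinearMapAt he h,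
    trace_eq_trace_of_continuousLinearMapAt he
      (S := (𝒥.matrix e y : F →ₗ[ℝ] F) ∘ₗ (S : F →ₗ[ℝ] F)) fun w ↦ ?_, complexTrace]
  exact (continuousLinearMapAt_complexStructure he _).trans congr(𝒥.matrix e y $(h w))

variable [ContMDiffVectorBundle ∞ F V (𝓡∂ 2)] [FiniteDimensional ℝ F]

theorem contMDiffAt_complexStructureMatrix (he : y ∈ e.baseSet) :
    ContMDiffAt (𝓡∂ 2) 𝓘(ℝ, F →L[ℝ] F) ∞ (𝒥.matrix e) y :=
  contMDiffAt_clm_of_basis (Module.finBasis ℝ F) fun _ ↦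
    (contMDiffAt_section_iff_continuousLinearMapAt he).1 <| (𝒥.J_smooth y).clm_bundle_apply <|
      (contMDiffOn_symmL e _).contMDiffAt (e.open_baseSet.mem_nhds he)

variable [IsManifold (𝓡∂ 2) ∞ M]

theorem mvfderiv_complexStructureMatrix (D : 𝒥.Connection) (he : y ∈ e.baseSet)
    (X : TangentSpace (𝓡∂ 2) y) :
    mvfderiv (𝓡∂ 2) (𝒥.matrix e) y X =
      𝒥.matrix e y * connectionMatrix e D.cov y X -
        connectionMatrix e D.cov y X * 𝒥.matrix e y := by
  ext v
  have hv := mdifferentiableAt_symmL (I := 𝓡∂ 2) he v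
  have hJv : MDifferentiableAt (𝓡∂ 2) ((𝓡∂ 2).prod 𝓘(ℝ, F))
      (T% (fun z ↦ 𝒥.J z (e.symmL ℝ z v))) y :=
    (𝒥.J_smooth.mdifferentiableAt (by simp)).clm_bundle_apply hv
  have hlin := congr(e.continuousLinearMapAt ℝ y $(D.complex_linear _ y X hv))
  rw [continuousLinearMapAt_complexStructure he, ← connectionMatrix_apply D.cov he,
    continuousLinearMapAt_cov D.cov he hJv] at hlin
  have hJ := (contMDiffAt_complexStructureMatrix (𝒥 := 𝒥) he).mdifferentiableAt (by simp)
  exact (mvfderiv_clm_comp (ContinuousLinearMap.apply ℝ F v) hJ X).symm.trans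
    (eq_sub_of_add_eq hlin)

variable (D D₁ D₂ : 𝒥.Connection)

/-- The `1`-form `tr (D₁ - D₂)`. -/
def traceForm (y : M) : TangentSpace (𝓡∂ 2) y →ₗ[ℝ] ℂ :=
  complexTraceₗ (𝒥.J y : V y →ₗ[ℝ] V y) ∘ₗ connectionDifference D₁.cov D₂.cov y

theorem traceForm_apply (he : y ∈ e.baseSet) (X : TangentSpace (𝓡∂ 2) y) :
    traceForm D₁ D₂ y X = complexTrace (𝒥.matrix e y : F →ₗ[ℝ] F)
      (connectionMatrix e D₁.cov y X - connectionMatrix e D₂.cov y X : F →L[ℝ] F) :=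
  complexTrace_eq_of_continuousLinearMapAt he
    (continuousLinearMapAt_connectionDifference _ _ he X)

variable [T2Space M] {c : M} (hc : y ∈ (extChartAt (𝓡∂ 2) c).source) (he : y ∈ e.baseSet)

include hc he

theorem trCurvature_coordField (v w : EuclideanSpace ℝ (Fin 2)) :
    D.trCurvature y (coordField (𝓡∂ 2) c v y) (coordField (𝓡∂ 2) c w y) =
      complexTrace (𝒥.matrix e y : F →ₗ[ℝ] F)
        (curvatureMatrix e D.toSmoothConnection c v w y : F →L[ℝ] F) :=
  complexTrace_eq_of_continuousLinearMapAt he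
    (continuousLinearMapAt_curvature D.toSmoothConnection hc he)

omit [T2Space M] hc in
theorem differenceCoeff_comm_complexStructureMatrix (v : EuclideanSpace ℝ (Fin 2)) :
    𝒥.matrix e y * differenceCoeff e D₁.toSmoothConnection D₂.toSmoothConnection c v y =
      differenceCoeff e D₁.toSmoothConnection D₂.toSmoothConnection c v y * 𝒥.matrix e y := by
  have h := (mvfderiv_complexStructureMatrix D₁ he (coordField (𝓡∂ 2) c v y)).symm.trans
    (mvfderiv_complexStructureMatrix D₂ he (coordField (𝓡∂ 2) c v y))
  simp only [differenceCoeff, connectionCoeff, mul_sub, sub_mul]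
  exact sub_eq_sub_iff_sub_eq_sub.1 h

theorem coordDeriv_oneFormCoeff_traceForm (v : EuclideanSpace ℝ (Fin 2)) (k : Fin 2)
    {Δ : M → F →L[ℝ] F}
    (hΔ : Δ = differenceCoeff e D₁.toSmoothConnection D₂.toSmoothConnection c (.single k 1)) :
    coordDeriv (𝓡∂ 2) c v (oneFormCoeff c (traceForm D₁ D₂) k) y =
      complexTrace (𝒥.matrix e y : F →ₗ[ℝ] F)
        (coordDeriv (𝓡∂ 2) c v Δ y + (connectionCoeff e D₂.toSmoothConnection c v y * Δ y -
          Δ y * connectionCoeff e D₂.toSmoothConnection c v y) : F →L[ℝ] F) := by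
  have hΔy : MDifferentiableAt (𝓡∂ 2) 𝓘(ℝ, F →L[ℝ] F) Δ y :=
    hΔ ▸ (contMDiffAt_differenceCoeff _ _ hc he).mdifferentiableAt (by simp)
  have hlocal : oneFormCoeff c (traceForm D₁ D₂) k =ᶠ[𝓝 y]
      fun z ↦ complexTrace (𝒥.matrix e z : F →ₗ[ℝ] F) (Δ z) := by
    filter_upwards [e.open_baseSet.mem_nhds he] with z hz
    exact hΔ ▸ traceForm_apply D₁ D₂ hz _
  rw [(coordDeriv_congr hlocal).eq_of_nhds]
  exact mvfderiv_complexTrace ((contMDiffAt_complexStructureMatrix he).mdifferentiableAt (by simp))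
    hΔy (mvfderiv_complexStructureMatrix D₂ he _)

omit he in
theorem contMDiffAt_oneFormCoeff_traceForm (k : Fin 2) :
    ContMDiffAt (𝓡∂ 2) 𝓘(ℝ, ℂ) ∞ (oneFormCoeff c (traceForm D₁ D₂) k) y := by
  have he := mem_baseSet_trivializationAt F V y
  refine (contMDiffAt_complexTrace (contMDiffAt_complexStructureMatrix (𝒥 := 𝒥) he)
    (contMDiffAt_differenceCoeff D₁.toSmoothConnection D₂.toSmoothConnection hc he
      (v := .single k 1))).congr_of_eventuallyEq ?_
  filter_upwards [(trivializationAt F V y).open_baseSet.mem_nhds he] with z hz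
  exact traceForm_apply D₁ D₂ hz _

omit hc he

theorem isSmoothOneForm_traceForm : IsSmoothOneForm (traceForm D₁ D₂) := fun _ k _ hy ↦
  contMDiffAt_oneFormCoeff_traceForm D₁ D₂ hy k

theorem hasContinuousCoeffs_trCurvature : HasContinuousCoeffs D.trCurvature := fun c y hc ↦ by
  have he := mem_baseSet_trivializationAt F V y
  have hU := (isOpen_extChartAt_source (I := 𝓡∂ 2) c).inter (trivializationAt F V y).open_baseSet
  refine ((contMDiffAt_complexTrace (contMDiffAt_complexStructureMatrix (𝒥 := 𝒥) he)
    (contMDiffAt_curvatureMatrix D.toSmoothConnection hc he (v := .single 0 1)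
      (w := .single 1 1))).continuousAt.congr_of_eventuallyEq ?_).continuousWithinAt
  filter_upwards [hU.mem_nhds ⟨hc, he⟩] with z hz
  exact trCurvature_coordField D hz.1 hz.2 _ _

theorem isExteriorDeriv_traceForm :
    IsExteriorDeriv (fun y X Y ↦ D₁.trCurvature y X Y - D₂.trCurvature y X Y)
      (traceForm D₁ D₂) := fun c y hc ↦ by
  have he := mem_baseSet_trivializationAt F V y
  have hcomm := complexTrace_commutator_of_comp_comm congr(ContinuousLinearMap.toLinearMap
    $(differenceCoeff_comm_complexStructureMatrix (c := c) D₁ D₂ he (.single 0 1)))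
  rw [coordCoeff, trCurvature_coordField D₁ hc he, trCurvature_coordField D₂ hc he,
    ← complexTrace_sub, ← ContinuousLinearMap.toLinearMap_sub,
    curvatureMatrix_sub_curvatureMatrix _ _ hc he,
    coordDeriv_oneFormCoeff_traceForm D₁ D₂ hc he _ _ rfl,
    coordDeriv_oneFormCoeff_traceForm D₁ D₂ hc he _ _ rfl, ← complexTrace_sub,
    ContinuousLinearMap.toLinearMap_add, complexTrace_add]
  exact add_eq_left.2 (hcomm _)

end TraceForm

section LagrangianTrace

theorem trace_eq_zero_of_skew {K W : Type*} [Field K] [CharZero K] [AddCommGroup W] [Module K W]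
    [FiniteDimensional K W] {B : LinearMap.BilinForm K W} (hB : B.Nondegenerate)
    {A : W →ₗ[K] W} (hA : ∀ v w, B (A v) w = -B v (A w)) : LinearMap.trace K W A = 0 := by
  have htranspose : (B.toDual hB).conj A = Module.Dual.transpose (R := K) (-A) := by
    ext f w
    obtain ⟨v, rfl⟩ := (B.toDual hB).surjective f
    rw [LinearEquiv.conj_apply_apply, LinearEquiv.symm_apply_apply]
    exact (hA v w).trans (map_neg (B v) (A w)).symm
  have htrace := LinearMap.trace_conj' A (B.toDual hB)
  rw [htranspose, LinearMap.trace_transpose', map_neg] at htrace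
  exact self_eq_neg.1 htrace.symm

theorem trace_eq_zero_of_isCompl {K W : Type*} [CommRing K] [IsDomain K] [IsPrincipalIdealRing K]
    [AddCommGroup W] [Module K W] [Module.Finite K W] [Module.Free K W]
    {S T : Submodule K W} (h : IsCompl S T) {A : W →ₗ[K] W}
    (hS : ∀ v ∈ S, A v ∈ T) (hT : ∀ v ∈ T, A v ∈ S) : LinearMap.trace K W A = 0 := by
  refine LinearMap.trace_eq_zero_of_mapsTo_ne (N := fun b : Bool ↦ cond b S T)
    ((DirectSum.isInternal_submodule_iff_isCompl _ (i := true) (j := false) (by simp)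
      (by ext b; cases b <;> simp)).2 h) not (by simp) ?_
  rintro (_ | _)
  · exact hT
  · exact hS

variable {W : Type*} [AddCommGroup W] [Module ℝ W] [FiniteDimensional ℝ W]
  {B : LinearMap.BilinForm ℝ W} {J : W →ₗ[ℝ] W} {L : Submodule ℝ W}

theorem isCompl_lagrangian_map (hB : B.Nondegenerate) (hJ : ∀ v, J (J v) = -v)
    (hpos : ∀ v, v ≠ 0 → 0 < B v (J v)) (hL : B.orthogonal L = L) : IsCompl L (L.map J) := by
  have hinj : Function.Injective J := fun v w h ↦ neg_injective (by rw [← hJ v, h, hJ])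
  have hdim := B.finrank_orthogonal hB L
  rw [hL] at hdim
  have hdisj : Disjoint L (L.map J) := by
    rw [Submodule.disjoint_def]
    rintro _ hv ⟨w, hw, rfl⟩
    by_contra hne
    have hw0 : w ≠ 0 := fun h ↦ hne (by rw [h, map_zero])
    rw [← hL] at hv
    exact (hpos w hw0).ne' (hv w hw)
  refine ⟨hdisj, codisjoint_iff.2 (Submodule.eq_top_of_disjoint _ _ ?_ hdisj)⟩
  rw [← (Submodule.equivMapOfInjective J hinj L).finrank_eq]
  have := L.finrank_le
  lia

theorem complexTrace_eq_zero_of_skew_of_lagrangian (hB : B.Nondegenerate)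
    (hJ : ∀ v, J (J v) = -v) (hpos : ∀ v, v ≠ 0 → 0 < B v (J v)) (hL : B.orthogonal L = L)
    {A : W →ₗ[ℝ] W} (hAJ : ∀ v, A (J v) = J (A v)) (hA : ∀ v w, B (A v) w = -B v (A w))
    (hAL : ∀ v ∈ L, A v ∈ L) : complexTrace J A = 0 := by
  -- The real part vanishes because `A` is skew, the imaginary part because `J A` swaps `L`, `J L`.
  have hJA : LinearMap.trace ℝ W (J ∘ₗ A) = 0 := by
    refine trace_eq_zero_of_isCompl (isCompl_lagrangian_map hB hJ hpos hL)
      (fun v hv ↦ ⟨A v, hAL v hv, rfl⟩) ?_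
    rintro _ ⟨v, hv, rfl⟩
    rw [LinearMap.comp_apply, hAJ, hJ]
    exact L.neg_mem (hAL v hv)
  rw [complexTrace, trace_eq_zero_of_skew hB hA, hJA]
  simp

end LagrangianTrace

section Unitary

variable {M : Type*} [TopologicalSpace M] [ChartedSpace (EuclideanHalfSpace 2) M]
  {F : Type*} [NormedAddCommGroup F] [NormedSpace ℝ F]
  {V : M → Type*} [TopologicalSpace (TotalSpace F V)]
  [∀ x, AddCommGroup (V x)] [∀ x, Module ℝ (V x)] [∀ x, TopologicalSpace (V x)]
  [FiberBundle F V] [VectorBundle ℝ F V]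

section Form

variable (P : BundlePair F V) (x : M)

theorem form_swap (v w : V x) : P.form x v w = -P.form x w v := by
  have h := P.form_alternating x (v + w)
  simp only [map_add, add_apply, P.form_alternating, zero_add, add_zero] at h
  exact eq_neg_of_add_eq_zero_left (add_comm (P.form x w v) _ ▸ h)

theorem form_toBilinForm_nondegenerate : (P.form x).toBilinForm.Nondegenerate :=
  ⟨P.form_nondegenerate x, fun v hv ↦ P.form_nondegenerate x v fun w ↦ by
    rw [form_swap, neg_eq_zero]
    exact hv w⟩

variable {x} in
theorem form_toBilinForm_orthogonal_L (hx : x ∈ (𝓡∂ 2).boundary M) :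
    (P.form x).toBilinForm.orthogonal (P.L x) = P.L x := by
  ext v
  rw [P.L_lagrangian x hx]
  refine forall₂_congr fun w _ ↦ ?_
  rw [form_swap P x v w, neg_eq_zero]
  rfl

end Form

variable [IsManifold (𝓡∂ 2) ∞ M] [∀ x, IsTopologicalAddGroup (V x)]
  [∀ x, ContinuousSMul ℝ (V x)] [ContMDiffVectorBundle ∞ F V (𝓡∂ 2)] [FiniteDimensional ℝ F]
  {P : BundlePair F V} {𝒥 : CompatibleComplexStructure P}
  {D₁ D₂ : 𝒥.Connection} {x : M} {X : TangentSpace (𝓡∂ 2) x}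

variable (D₁ D₂ X) in
theorem connectionDifference_complexStructure (v : V x) :
    connectionDifference D₁.cov D₂.cov x X (𝒥.J x v) =
      𝒥.J x (connectionDifference D₁.cov D₂.cov x X v) := by
  have hv := FiberBundle.mdifferentiableAt_extend (𝓡∂ 2) F v
  have hJv : MDifferentiableAt (𝓡∂ 2) ((𝓡∂ 2).prod 𝓘(ℝ, F))
      (T% (fun z ↦ 𝒥.J z (FiberBundle.extend F v z))) x :=
    (𝒥.J_smooth.mdifferentiableAt (by simp)).clm_bundle_apply hv
  have h := connectionDifference_apply D₁.cov D₂.cov hJv X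
  rwa [D₁.complex_linear _ x X hv, D₂.complex_linear _ x X hv, FiberBundle.extend_apply_self,
    ← map_sub, ← connectionDifference_extend] at h

theorem connectionDifference_skew (h₁ : D₁.IsUnitaryInDirection x X)
    (h₂ : D₂.IsUnitaryInDirection x X) (v w : V x) :
    P.form x (connectionDifference D₁.cov D₂.cov x X v) w =
      -P.form x v (connectionDifference D₁.cov D₂.cov x X w) := by
  have hv := FiberBundle.mdifferentiableAt_extend (𝓡∂ 2) F v
  have hw := FiberBundle.mdifferentiableAt_extend (𝓡∂ 2) F w
  have h := congrArg Complex.im ((h₁ _ _ hv hw).symm.trans (h₂ _ _ hv hw))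
  simp only [CompatibleComplexStructure.hermitian, FiberBundle.extend_apply_self, Complex.add_im,
    Complex.ofReal_im, Complex.mul_im, Complex.I_re, Complex.I_im, Complex.ofReal_re, zero_mul,
    one_mul, zero_add] at h
  rw [connectionDifference_extend, connectionDifference_extend, map_sub, map_sub, sub_apply]
  linarith

theorem traceForm_eq_zero_of_preserves_lagrangian (hx : x ∈ (𝓡∂ 2).boundary M)
    (h₁ : D₁.IsUnitaryInDirection x X) (h₂ : D₂.IsUnitaryInDirection x X)
    (hL : ∀ v ∈ P.L x, connectionDifference D₁.cov D₂.cov x X v ∈ P.L x) :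
    traceForm D₁ D₂ x X = 0 :=
  have : FiniteDimensional ℝ (V x) := VectorBundle.finiteDimensional ℝ F V x
  complexTrace_eq_zero_of_skew_of_lagrangian (form_toBilinForm_nondegenerate P x) (𝒥.J_sq x)
    (𝒥.pos x) (form_toBilinForm_orthogonal_L P hx)
    (connectionDifference_complexStructure D₁ D₂ X) (connectionDifference_skew h₁ h₂) hL

end Unitary

theorem exists_hasDerivWithinAt_linear {F : Type*} [NormedAddCommGroup F] [NormedSpace ℝ F]
    [CompleteSpace F] {Γ : ℝ → F →L[ℝ] F} {δ : ℝ} (hδ : 0 < δ) (hΓ : ContinuousOn Γ (Icc 0 δ))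
    (v : F) :
    ∃ b ∈ Ioc 0 δ, ∃ c : ℝ → F, c 0 = v ∧
      ∀ t ∈ Icc 0 b, HasDerivWithinAt c (Γ t (c t)) (Icc 0 b) t := by
  obtain ⟨K, hK⟩ := isCompact_Icc.exists_bound_of_continuousOn hΓ
  have hK0 : 0 ≤ K := (norm_nonneg _).trans (hK 0 ⟨le_rfl, hδ.le⟩)
  lift K to NNReal using hK0
  -- `C` bounds the vector field on the unit ball around `v`, so solutions stay there up to `1 / C`.
  set C : NNReal := K * (‖v‖₊ + 1) + 1 with hC
  have : 0 < C := by positivity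
  set b : ℝ := min δ (C : ℝ)⁻¹
  have hb0 : 0 < b := lt_min hδ (by positivity)
  have hbδ : b ≤ δ := min_le_left _ _
  have hpicard :
      IsPicardLindelof (fun t x ↦ Γ t x) (⟨0, le_rfl, hb0.le⟩ : Icc 0 b) v 1 0 C K := by
    refine ⟨fun t ht ↦ ?_, fun x _ ↦ ?_, fun t ht x hx ↦ ?_, ?_⟩
    · refine (LipschitzWith.of_dist_le_mul fun x y ↦ ?_).lipschitzOnWith
      rw [dist_eq_norm, ← map_sub, dist_eq_norm]
      exact (Γ t).le_of_opNorm_le (hK t ⟨ht.1, ht.2.trans hbδ⟩) _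
    · exact (hΓ.mono (Icc_subset_Icc_right hbδ)).clm_apply continuousOn_const
    · have hx' : ‖x‖ ≤ ‖v‖ + 1 := norm_le_of_mem_closedBall hx
      calc ‖Γ t x‖ ≤ K * ‖x‖ := (Γ t).le_of_opNorm_le (hK t ⟨ht.1, ht.2.trans hbδ⟩) _
        _ ≤ K * (‖v‖ + 1) := by gcongr
        _ ≤ C := by simp [hC]
    · have hCb : (C : ℝ) * b ≤ 1 := by
        calc (C : ℝ) * b ≤ C * (C : ℝ)⁻¹ := by gcongr; exact min_le_right _ _
          _ = 1 := mul_inv_cancel₀ (by positivity)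
      simpa [hb0.le] using hCb
  obtain ⟨c, hc0, hc⟩ := hpicard.exists_eq_forall_mem_Icc_hasDerivWithinAt₀
  exact ⟨b, ⟨hb0, hbδ⟩, c, hc0, hc⟩

theorem hasDerivWithinAt_comp_curve {E H M G : Type*} [NormedAddCommGroup E] [NormedSpace ℝ E]
    [TopologicalSpace H] {I : ModelWithCorners ℝ E H} [TopologicalSpace M] [ChartedSpace H M]
    [NormedAddCommGroup G] [NormedSpace ℝ G] {f : M → G} {γ : ℝ → M} {s : Set ℝ} {t : ℝ}
    (hf : MDifferentiableAt I 𝓘(ℝ, G) f (γ t)) (hγ : MDifferentiableWithinAt 𝓘(ℝ, ℝ) I γ s t) :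
    HasDerivWithinAt (fun u ↦ f (γ u))
      (mvfderiv I f (γ t) (mfderivWithin 𝓘(ℝ, ℝ) I γ s t (1 : ℝ))) s t :=
  HasFDerivWithinAt.hasDerivWithinAt (f := f ∘ γ) (F := G) <|
    (hf.hasMFDerivAt.comp_hasMFDerivWithinAt t hγ.hasMFDerivWithinAt).hasFDerivWithinAt

section BoundaryCurve

variable {M : Type*} [TopologicalSpace M] [ChartedSpace (EuclideanHalfSpace 2) M]

/-- The line through `x` parallel to the boundary, in the chart at `x`. -/
def boundaryLine (x : M) (t : ℝ) : EuclideanSpace ℝ (Fin 2) :=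
  extChartAt (𝓡∂ 2) x x + t • .single 1 1

/-- The curve through `x` parallel to the boundary in the chart at `x`; it has junk values at the
times at which `boundaryLine x` is outside of the target of the chart. -/
def boundaryCurve (x : M) (t : ℝ) : M := (extChartAt (𝓡∂ 2) x).symm (boundaryLine x t)

theorem boundaryCurve_zero (x : M) : boundaryCurve x 0 = x := by
  rw [boundaryCurve, boundaryLine, zero_smul, add_zero]
  exact extChartAt_to_inv x

theorem hasDerivAt_boundaryLine (x : M) (t : ℝ) :
    HasDerivAt (boundaryLine x) (.single 1 1) t := by
  have hline := ((hasDerivAt_id t).smul_const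
    (EuclideanSpace.single (1 : Fin 2) (1 : ℝ))).const_add (extChartAt (𝓡∂ 2) x x)
  rwa [one_smul] at hline

theorem boundaryLine_apply_zero (x : M) (t : ℝ) :
    boundaryLine x t 0 = extChartAt (𝓡∂ 2) x x 0 := by
  rw [boundaryLine, PiLp.add_apply, PiLp.smul_apply]
  simp

theorem boundaryLine_mem_range (x : M) (t : ℝ) : boundaryLine x t ∈ range (𝓡∂ 2) := by
  rw [mem_range_halfSpace, boundaryLine_apply_zero]
  exact mem_range_halfSpace.1 (extChartAt_target_subset_range x (mem_extChartAt_target x))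

theorem tendsto_boundaryCurve (x : M) : Filter.Tendsto (boundaryCurve x) (𝓝 0) (𝓝 x) := by
  have hline := (hasDerivAt_boundaryLine x 0).continuousAt
  have hsymm := continuousAt_extChartAt_symm (I := 𝓡∂ 2) x
  rw [ContinuousAt, extChartAt_to_inv] at hsymm
  rw [ContinuousAt, boundaryLine, zero_smul, add_zero] at hline
  exact hsymm.comp hline

variable {x : M} {b t : ℝ}

theorem exists_boundaryLine_mem_target {U : Set M} (hU : U ∈ 𝓝 x) :
    ∃ δ > 0, ∀ t ∈ Icc 0 δ, boundaryLine x t ∈ (extChartAt (𝓡∂ 2) x).target ∧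
      boundaryCurve x t ∈ U := by
  have hline : Filter.Tendsto (boundaryLine x) (𝓝 0)
      (𝓝[range (𝓡∂ 2)] (extChartAt (𝓡∂ 2) x x)) := by
    refine tendsto_nhdsWithin_iff.2 ⟨?_, Filter.Eventually.of_forall (boundaryLine_mem_range x)⟩
    simpa only [ContinuousAt, boundaryLine, zero_smul, add_zero] using
      (hasDerivAt_boundaryLine x 0).continuousAt
  obtain ⟨ε, hε, hball⟩ := Metric.eventually_nhds_iff_ball.1
    ((hline.eventually_mem (extChartAt_target_mem_nhdsWithin x)).and (tendsto_boundaryCurve x hU))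
  refine ⟨ε / 2, by positivity, fun t ht ↦ hball t ?_⟩
  rw [Metric.mem_ball, dist_zero_right, Real.norm_of_nonneg ht.1]
  linarith [ht.2]

theorem boundaryCurve_mem_source (ht : boundaryLine x t ∈ (extChartAt (𝓡∂ 2) x).target) :
    boundaryCurve x t ∈ (extChartAt (𝓡∂ 2) x).source :=
  (extChartAt (𝓡∂ 2) x).map_target ht

variable [IsManifold (𝓡∂ 2) ∞ M]

theorem boundaryCurve_mem_boundary (hx : x ∈ (𝓡∂ 2).boundary M)
    (ht : boundaryLine x t ∈ (extChartAt (𝓡∂ 2) x).target) :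
    boundaryCurve x t ∈ (𝓡∂ 2).boundary M := by
  rw [mem_boundary_iff_extChartAt (boundaryCurve_mem_source ht), boundaryCurve,
    (extChartAt (𝓡∂ 2) x).right_inv ht, boundaryLine_apply_zero]
  exact (mem_boundary_iff_extChartAt (mem_extChartAt_source x)).1 hx

theorem contMDiffOn_boundaryCurve
    (hb : ∀ t ∈ Icc 0 b, boundaryLine x t ∈ (extChartAt (𝓡∂ 2) x).target) :
    ContMDiffOn 𝓘(ℝ, ℝ) (𝓡∂ 2) ∞ (boundaryCurve x) (Icc 0 b) := by
  have h : ContDiff ℝ ∞ (boundaryLine x) := contDiff_const.add (contDiff_id.smul contDiff_const)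
  exact (contMDiffOn_extChartAt_symm x).comp h.contMDiff.contMDiffOn hb

theorem mfderivWithin_boundaryCurve (hb0 : 0 < b)
    (hb : ∀ t ∈ Icc 0 b, boundaryLine x t ∈ (extChartAt (𝓡∂ 2) x).target) (ht : t ∈ Icc 0 b) :
    mfderivWithin 𝓘(ℝ, ℝ) (𝓡∂ 2) (boundaryCurve x) (Icc 0 b) t (1 : ℝ) =
      coordField (𝓡∂ 2) x (.single 1 1) (boundaryCurve x t) := by
  have hline := (hasDerivAt_boundaryLine x t).hasDerivWithinAt (s := Icc 0 b)
  have hsymm := (mdifferentiableWithinAt_extChartAt_symm (hb t ht)).hasMFDerivWithinAt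
  have hcurve := hsymm.comp t hline.hasFDerivWithinAt.hasMFDerivWithinAt
    fun s _ ↦ boundaryLine_mem_range x s
  rw [coordField_eq_mfderivWithin (boundaryCurve_mem_source (hb t ht)), boundaryCurve,
    (extChartAt (𝓡∂ 2) x).right_inv (hb t ht)]
  refine congr($(hcurve.mfderivWithin (uniqueDiffOn_Icc hb0 t ht).uniqueMDiffWithinAt)
    (1 : ℝ)).trans ?_
  exact congrArg _ (one_smul ℝ _)

end BoundaryCurve

section Parallel

variable {E : Type*} [NormedAddCommGroup E] [NormedSpace ℝ E] {H : Type*} [TopologicalSpace H]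
  {I : ModelWithCorners ℝ E H} {M : Type*} [TopologicalSpace M] [ChartedSpace H M]
  {F : Type*} [NormedAddCommGroup F] [NormedSpace ℝ F]
  {V : M → Type*} [TopologicalSpace (TotalSpace F V)]
  [∀ x, AddCommGroup (V x)] [∀ x, Module ℝ (V x)] [∀ x, TopologicalSpace (V x)]
  [FiberBundle F V] [VectorBundle ℝ F V]
  {e e' : Trivialization F (TotalSpace.proj : TotalSpace F V → M)}
  [MemTrivializationAtlas e] [MemTrivializationAtlas e'] {y : M}

theorem coordChangeL_apply_eq_continuousLinearMapAt (he : y ∈ e.baseSet) (he' : y ∈ e'.baseSet)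
    (v : F) : e.coordChangeL ℝ e' y v = e'.continuousLinearMapAt ℝ y (e.symmL ℝ y v) := by
  rw [e.coordChangeL_apply e' ⟨he, he'⟩, e'.continuousLinearMapAt_apply_of_mem ℝ he',
    e.symmL_apply he]

variable [ContMDiffVectorBundle ∞ F V I]

theorem mdifferentiableAt_coordChangeL (he : y ∈ e.baseSet) (he' : y ∈ e'.baseSet) :
    MDifferentiableAt I 𝓘(ℝ, F →L[ℝ] F) (fun z ↦ (e.coordChangeL ℝ e' z : F →L[ℝ] F)) y :=
  ((contMDiffOn_coordChangeL (n := ∞) e e').contMDiffAt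
    ((e.open_baseSet.inter e'.open_baseSet).mem_nhds ⟨he, he'⟩)).mdifferentiableAt (by simp)

variable [IsManifold I ∞ M] [∀ x, IsTopologicalAddGroup (V x)] [∀ x, ContinuousSMul ℝ (V x)]
  [FiniteDimensional ℝ F]

theorem coordChangeL_connectionMatrix (D : CovariantDerivative I F V) (he : y ∈ e.baseSet)
    (he' : y ∈ e'.baseSet) (X : TangentSpace I y) (v : F) :
    e.coordChangeL ℝ e' y (connectionMatrix e D y X v) =
      mvfderiv I (fun z ↦ (e.coordChangeL ℝ e' z : F →L[ℝ] F)) y X v +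
        connectionMatrix e' D y X (e.coordChangeL ℝ e' y v) := by
  have hlocal : (fun z ↦ e'.continuousLinearMapAt ℝ z (e.symmL ℝ z v)) =ᶠ[𝓝 y]
      fun z ↦ ContinuousLinearMap.apply ℝ F v (e.coordChangeL ℝ e' z : F →L[ℝ] F) := by
    filter_upwards [e.open_baseSet.mem_nhds he, e'.open_baseSet.mem_nhds he'] with z hz hz'
    exact (coordChangeL_apply_eq_continuousLinearMapAt hz hz' v).symm
  rw [connectionMatrix_apply D he, coordChangeL_apply_eq_continuousLinearMapAt he he',
    e.symmL_continuousLinearMapAt he,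
    continuousLinearMapAt_cov D he' (mdifferentiableAt_symmL he v), mvfderiv_congr hlocal,
    coordChangeL_apply_eq_continuousLinearMapAt he he']
  exact congrArg (· + _) (mvfderiv_clm_comp (ContinuousLinearMap.apply ℝ F v)
    (mdifferentiableAt_coordChangeL he he') X)

theorem continuousLinearMapAt_cov_extend (D : CovariantDerivative I F V) (X : TangentSpace I y)
    (w : V y) :
    (trivializationAt F V y).continuousLinearMapAt ℝ y (D (FiberBundle.extend F w) y X) =
      connectionMatrix (trivializationAt F V y) D y X
        ((trivializationAt F V y).continuousLinearMapAt ℝ y w) := by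
  set e₀ := trivializationAt F V y
  have hy : y ∈ e₀.baseSet := mem_baseSet_trivializationAt F V y
  have hconst : (fun z ↦ e₀.continuousLinearMapAt ℝ z (FiberBundle.extend F w z)) =ᶠ[𝓝 y]
      fun _ ↦ (e₀ ⟨y, w⟩).2 := by
    filter_upwards [e₀.open_baseSet.mem_nhds hy] with z hz
    exact (congrArg _ (e₀.symmL_apply hz _).symm).trans (e₀.continuousLinearMapAt_symmL hz _)
  rw [continuousLinearMapAt_cov D hy (FiberBundle.mdifferentiableAt_extend I F w),
    mvfderiv_congr hconst, mvfderiv_const, zero_apply, zero_add, FiberBundle.extend_apply_self]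

end Parallel

section ParallelAlong

variable {M : Type*} [TopologicalSpace M] [ChartedSpace (EuclideanHalfSpace 2) M]
  [IsManifold (𝓡∂ 2) ∞ M]
  {F : Type*} [NormedAddCommGroup F] [NormedSpace ℝ F]
  {V : M → Type*} [TopologicalSpace (TotalSpace F V)]
  [∀ x, AddCommGroup (V x)] [∀ x, Module ℝ (V x)] [∀ x, TopologicalSpace (V x)]
  [∀ x, IsTopologicalAddGroup (V x)] [∀ x, ContinuousSMul ℝ (V x)]
  [FiberBundle F V] [VectorBundle ℝ F V] [ContMDiffVectorBundle ∞ F V (𝓡∂ 2)]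
  [FiniteDimensional ℝ F]
  {e : Trivialization F (TotalSpace.proj : TotalSpace F V → M)} [MemTrivializationAtlas e]

theorem isParallelAlong_symmL (D : SmoothConnection F V) {γ : ℝ → M} {a b : ℝ}
    (hγ : MDifferentiableOn 𝓘(ℝ, ℝ) (𝓡∂ 2) γ (Icc a b)) (hγe : ∀ t ∈ Icc a b, γ t ∈ e.baseSet)
    {c : ℝ → F}
    (hc : ∀ t ∈ Icc a b, HasDerivWithinAt c (-(connectionMatrix e D.cov (γ t)
      (mfderivWithin 𝓘(ℝ, ℝ) (𝓡∂ 2) γ (Icc a b) t (1 : ℝ)) (c t))) (Icc a b) t) :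
    D.IsParallelAlong γ a b fun t ↦ e.symmL ℝ (γ t) (c t) := by
  intro t ht
  set e' := trivializationAt F V (γ t)
  have he := hγe t ht
  have he' : γ t ∈ e'.baseSet := mem_baseSet_trivializationAt F V (γ t)
  have hcoordChange := hasDerivWithinAt_comp_curve (mdifferentiableAt_coordChangeL he he') (hγ t ht)
  refine ⟨_, (hcoordChange.clm_apply (hc t ht)).congr_of_eventuallyEq_of_mem ?_ ht, ?_⟩
  · filter_upwards [(hγ t ht).continuousWithinAt (e'.open_baseSet.mem_nhds he'),
      self_mem_nhdsWithin] with u hu hut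
    rw [← e'.continuousLinearMapAt_apply_of_mem ℝ hu,
      ← coordChangeL_apply_eq_continuousLinearMapAt (hγe u hut) hu]
    rfl
  · rw [← e'.symmL_apply (R := ℝ) he', ← e'.symmL_continuousLinearMapAt (R := ℝ) he' (D.cov _ _ _),
      continuousLinearMapAt_cov_extend, ← coordChangeL_apply_eq_continuousLinearMapAt he he',
      ← map_add, map_neg, add_right_comm]
    refine (congrArg _ ?_).trans (map_zero _)
    exact add_neg_eq_zero.2 (coordChangeL_connectionMatrix D.cov he he' _ _).symm

end ParallelAlong

section Lagrangian

variable {M : Type*} [TopologicalSpace M] [ChartedSpace (EuclideanHalfSpace 2) M]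
  {F : Type*} [NormedAddCommGroup F] [NormedSpace ℝ F]
  {V : M → Type*} [TopologicalSpace (TotalSpace F V)]
  [∀ x, AddCommGroup (V x)] [∀ x, Module ℝ (V x)] [∀ x, TopologicalSpace (V x)]
  [FiberBundle F V] [VectorBundle ℝ F V] {x : M}

variable (P : BundlePair F V)

theorem tendsto_form_symmL {ι : Type*} {l : Filter ι} {z : ι → M} (hz : Filter.Tendsto z l (𝓝 x))
    {a b : ι → F} {a₀ b₀ : F} (ha : Filter.Tendsto a l (𝓝 a₀)) (hb : Filter.Tendsto b l (𝓝 b₀)) :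
    Filter.Tendsto (fun i ↦ P.form (z i) ((trivializationAt F V x).symmL ℝ (z i) (a i))
        ((trivializationAt F V x).symmL ℝ (z i) (b i))) l
      (𝓝 (P.form x ((trivializationAt F V x).symmL ℝ x a₀)
        ((trivializationAt F V x).symmL ℝ x b₀))) := by
  have hform := ((contMDiffAt_hom_bundle _).1 (P.form_smooth x)).2.continuousAt.tendsto.comp hz
  have hcoord : ∀ y ∈ (trivializationAt F V x).baseSet, ∀ v w,
      ContinuousLinearMap.inCoordinates F V (F →L[ℝ] ℝ) (fun y ↦ V y →L[ℝ] ℝ) x y x y (P.form y)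
        v w = P.form y ((trivializationAt F V x).symmL ℝ y v)
          ((trivializationAt F V x).symmL ℝ y w) := fun y hy v w ↦ by
    rw [inCoordinates_apply_eq₂ hy hy (mem_univ _),
      Trivialization.symmL_apply _ hy, Trivialization.symmL_apply _ hy]
    simp
  have hx := mem_baseSet_trivializationAt F V x
  rw [← hcoord x hx]
  have hform_a := (isBoundedBilinearMap_apply.continuous.tendsto _).comp (hform.prodMk_nhds ha)
  have hform_ab := (isBoundedBilinearMap_apply.continuous.tendsto _).comp (hform_a.prodMk_nhds hb)
  refine hform_ab.congr' ?_
  filter_upwards [hz ((trivializationAt F V x).open_baseSet.mem_nhds hx)] with i hi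
  exact hcoord _ hi _ _

theorem form_symmL_eq_zero_of_hasDerivWithinAt {γ : ℝ → M}
    (hγ : Filter.Tendsto γ (𝓝[>] 0) (𝓝 x)) {c u : ℝ → F} {c' u₀ : F} (hc0 : c 0 = 0)
    (hc : HasDerivWithinAt c c' (Ioi 0) 0) (hu : Filter.Tendsto u (𝓝[>] 0) (𝓝 u₀))
    (horthogonal : ∀ᶠ t in 𝓝[>] (0 : ℝ),
      P.form (γ t) ((trivializationAt F V x).symmL ℝ (γ t) (c t))
        ((trivializationAt F V x).symmL ℝ (γ t) (u t)) = 0) :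
    P.form x ((trivializationAt F V x).symmL ℝ x c')
      ((trivializationAt F V x).symmL ℝ x u₀) = 0 := by
  have hslope := (hasDerivWithinAt_iff_tendsto_slope' self_notMem_Ioi).1 hc
  refine tendsto_nhds_unique ((tendsto_form_symmL P hγ hslope hu).congr' ?_) tendsto_const_nhds
  filter_upwards [horthogonal] with t ht
  rw [slope_def_module, hc0, sub_zero, sub_zero, map_smul, map_smul, smul_apply, ht, smul_zero]

variable [IsManifold (𝓡∂ 2) ∞ M] [T2Space M]
  [∀ x, IsTopologicalAddGroup (V x)] [∀ x, ContinuousSMul ℝ (V x)]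
  [ContMDiffVectorBundle ∞ F V (𝓡∂ 2)] [FiniteDimensional ℝ F]

theorem exists_parallel_lift {D : SmoothConnection F V} {L : Π x : M, Submodule ℝ (V x)}
    (hD : D.PreservesAlongBoundary L) (hx : x ∈ (𝓡∂ 2).boundary M) {v : V x} (hv : v ∈ L x) :
    ∃ c : ℝ → F, c 0 = (trivializationAt F V x).continuousLinearMapAt ℝ x v ∧
      HasDerivWithinAt c
        (-connectionCoeff (trivializationAt F V x) D x (.single 1 1) x (c 0)) (Ioi 0) 0 ∧
      ∀ᶠ t in 𝓝[>] (0 : ℝ),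
        (trivializationAt F V x).symmL ℝ (boundaryCurve x t) (c t) ∈ L (boundaryCurve x t) := by
  set e := trivializationAt F V x
  have hxe : x ∈ e.baseSet := mem_baseSet_trivializationAt F V x
  obtain ⟨δ, hδ, hγ⟩ := exists_boundaryLine_mem_target (e.open_baseSet.mem_nhds hxe)
  have hΓ : ContinuousOn (fun t ↦ connectionCoeff e D x (.single 1 1) (boundaryCurve x t))
      (Icc 0 δ) := fun t ht ↦
    (contMDiffAt_connectionCoeff D (boundaryCurve_mem_source (hγ t ht).1)
      (hγ t ht).2).continuousAt.comp_continuousWithinAt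
      ((contMDiffOn_boundaryCurve fun s hs ↦ (hγ s hs).1).continuousOn t ht)
  obtain ⟨b, ⟨hb0, hbδ⟩, c, hc0, hc⟩ :=
    exists_hasDerivWithinAt_linear hδ hΓ.neg (e.continuousLinearMapAt ℝ x v)
  refine ⟨c, hc0, ?_, ?_⟩
  · have hderiv := hc 0 ⟨le_rfl, hb0.le⟩
    rw [Pi.neg_apply, boundaryCurve_zero] at hderiv
    exact hderiv.mono_of_mem_nhdsWithin
      (Filter.mem_of_superset (Ioc_mem_nhdsGT hb0) Ioc_subset_Icc_self)
  · filter_upwards [Ioc_mem_nhdsGT hb0] with t ht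
    have hsub : Icc 0 t ⊆ Icc 0 b := Icc_subset_Icc_right ht.2
    replace hγ : ∀ s ∈ Icc 0 t, _ := fun s hs ↦ hγ s (Icc_subset_Icc_right (ht.2.trans hbδ) hs)
    have hsmooth := contMDiffOn_boundaryCurve fun s hs ↦ (hγ s hs).1
    have hparallel := isParallelAlong_symmL D (hsmooth.mdifferentiableOn (by simp))
      (fun s hs ↦ (hγ s hs).2) fun s hs ↦ by
        rw [mfderivWithin_boundaryCurve ht.1 (fun s hs ↦ (hγ s hs).1) hs]
        exact (hc s (hsub hs)).mono hsub
    refine hD _ 0 t ht.1 hsmooth (fun s hs ↦ boundaryCurve_mem_boundary hx (hγ s hs).1) _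
      hparallel ?_
    rwa [boundaryCurve_zero, hc0, e.symmL_continuousLinearMapAt hxe]

variable {P}

theorem connectionDifference_mem_lagrangian {D₁ D₂ : SmoothConnection F V}
    (h₁ : D₁.PreservesAlongBoundary P.L) (h₂ : D₂.PreservesAlongBoundary P.L)
    (hx : x ∈ (𝓡∂ 2).boundary M) {v : V x} (hv : v ∈ P.L x) :
    connectionDifference D₁.cov D₂.cov x (coordField (𝓡∂ 2) x (.single 1 1) x) v ∈ P.L x := by
  set e := trivializationAt F V x
  have hxe : x ∈ e.baseSet := mem_baseSet_trivializationAt F V x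
  refine (P.L_lagrangian x hx _).2 fun w hw ↦ ?_
  obtain ⟨c₁, hc₁0, hc₁, hc₁L⟩ := exists_parallel_lift h₁ hx hv
  obtain ⟨c₂, hc₂0, hc₂, hc₂L⟩ := exists_parallel_lift h₂ hx hv
  obtain ⟨u, hu0, hu, huL⟩ := exists_parallel_lift h₁ hx hw
  obtain ⟨δ, hδ, hγ⟩ := exists_boundaryLine_mem_target (x := x) Filter.univ_mem
  have hzero := form_symmL_eq_zero_of_hasDerivWithinAt P
    ((tendsto_boundaryCurve x).mono_left nhdsWithin_le_nhds) (by simp [hc₁0, hc₂0])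
    (hc₂.sub hc₁) hu.continuousWithinAt.tendsto ?_
  · rw [hc₁0, hc₂0, hu0, e.symmL_continuousLinearMapAt hxe, neg_sub_neg, ← sub_apply] at hzero
    rw [← e.symmL_continuousLinearMapAt (R := ℝ) hxe (connectionDifference _ _ _ _ _),
      continuousLinearMapAt_connectionDifference _ _ hxe]
    exact hzero
  · filter_upwards [hc₁L, hc₂L, huL, Ioc_mem_nhdsGT hδ] with t hc₁t hc₂t hut ht
    have hb := boundaryCurve_mem_boundary hx (hγ t (Ioc_subset_Icc_self ht)).1
    refine (P.L_lagrangian _ hb _).1 ?_ _ hut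
    rw [Pi.sub_apply, map_sub]
    exact sub_mem hc₂t hc₁t

theorem traceForm_eq_zero_of_mem_boundaryTangent {𝒥 : CompatibleComplexStructure P}
    {D₁ D₂ : 𝒥.Connection} (h₁ : D₁.RestrictsToLOrthogonalUnitary)
    (h₂ : D₂.RestrictsToLOrthogonalUnitary) (hx : x ∈ (𝓡∂ 2).boundary M)
    {X : TangentSpace (𝓡∂ 2) x} (hX : X ∈ boundaryTangent x) : traceForm D₁ D₂ x X = 0 := by
  set Y := coordField (𝓡∂ 2) x (.single 1 1) x
  have hxx := mem_extChartAt_source (I := 𝓡∂ 2) x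
  have hY : Y ∈ boundaryTangent x := coordField_mem_boundaryTangent hxx hx (by simp)
  have hYX : X = (show EuclideanSpace ℝ (Fin 2) from X) 1 • Y := by
    have hYsingle : (show EuclideanSpace ℝ (Fin 2) from Y) = .single 1 1 := by
      rw [show Y = _ from coordField_eq_mfderivWithin hxx, mfderivWithin_range_extChartAt_symm]
      rfl
    change (show EuclideanSpace ℝ (Fin 2) from X) = (_ : ℝ) • (show EuclideanSpace ℝ (Fin 2) from Y)
    rw [hYsingle]
    ext i
    fin_cases i
    · have hX0 : (show EuclideanSpace ℝ (Fin 2) from X) 0 = 0 := hX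
      simpa using hX0
    · simp
  rw [hYX, map_smul, traceForm_eq_zero_of_preserves_lagrangian hx (h₁.1 x hx Y hY) (h₂.1 x hx Y hY)
    fun v hv ↦ connectionDifference_mem_lagrangian h₁.2 h₂.2 hx hv, smul_zero]

end Lagrangian

section Main

variable {M : Type*} [TopologicalSpace M] [ChartedSpace (EuclideanHalfSpace 2) M]
  [IsRiemannSurface M] [T2Space M] [CompactSpace M]
  {F : Type*} [NormedAddCommGroup F] [NormedSpace ℝ F] [FiniteDimensional ℝ F]
  {V : M → Type*} [TopologicalSpace (TotalSpace F V)]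
  [∀ x, AddCommGroup (V x)] [∀ x, Module ℝ (V x)] [∀ x, TopologicalSpace (V x)]
  [∀ x, IsTopologicalAddGroup (V x)] [∀ x, ContinuousSMul ℝ (V x)]
  [FiberBundle F V] [VectorBundle ℝ F V] [ContMDiffVectorBundle ∞ F V (𝓡∂ 2)]
  {P : BundlePair F V} {𝒥 : CompatibleComplexStructure P}

theorem surfaceIntegral_trCurvature_eq {D₁ D₂ : 𝒥.Connection}
    (h₁ : D₁.RestrictsToLOrthogonalUnitary) (h₂ : D₂.RestrictsToLOrthogonalUnitary) :
    surfaceIntegral D₁.trCurvature = surfaceIntegral D₂.trCurvature := by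
  rw [← sub_eq_zero, ← surfaceIntegral_sub (hasContinuousCoeffs_trCurvature D₁)
    (hasContinuousCoeffs_trCurvature D₂)]
  exact surfaceIntegral_eq_zero_of_isExteriorDeriv (isExteriorDeriv_traceForm D₁ D₂)
    (isSmoothOneForm_traceForm D₁ D₂)
    fun x hx X hX ↦ traceForm_eq_zero_of_mem_boundaryTangent h₁ h₂ hx hX

end Main

end

end MaslovCW

theorem mainTheorem5
    {M : Type*} [TopologicalSpace M] [T2Space M] [CompactSpace M]
    [ChartedSpace (EuclideanHalfSpace 2) M] [MaslovCW.IsRiemannSurface M]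
    {F : Type*} [NormedAddCommGroup F] [NormedSpace ℝ F] [FiniteDimensional ℝ F]
    {V : M → Type*} [TopologicalSpace (TotalSpace F V)]
    [∀ x, AddCommGroup (V x)] [∀ x, Module ℝ (V x)] [∀ x, TopologicalSpace (V x)]
    [∀ x, IsTopologicalAddGroup (V x)] [∀ x, ContinuousSMul ℝ (V x)]
    [FiberBundle F V] [VectorBundle ℝ F V] [ContMDiffVectorBundle ∞ F V (𝓡∂ 2)]
    (P : MaslovCW.BundlePair F V) (𝒥 : MaslovCW.CompatibleComplexStructure P) :
    (∀ D₁ D₂ : 𝒥.Connection, D₁.IsLOrthogonalUnitary → D₂.IsLOrthogonalUnitary →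
      MaslovCW.surfaceIntegral D₁.trCurvature = MaslovCW.surfaceIntegral D₂.trCurvature) ∧
    ∃ μ : ℂ, ∀ D : 𝒥.Connection, D.RestrictsToLOrthogonalUnitary →
      Complex.I / (Real.pi : ℂ) * MaslovCW.surfaceIntegral D.trCurvature = μ := by
  refine ⟨fun D₁ D₂ h₁ h₂ ↦ MaslovCW.surfaceIntegral_trCurvature_eq
    ⟨fun x _ X _ ↦ h₁.1 x X, h₁.2⟩ ⟨fun x _ X _ ↦ h₂.1 x X, h₂.2⟩, ?_⟩
  by_cases h : ∃ D : 𝒥.Connection, D.RestrictsToLOrthogonalUnitary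
  · obtain ⟨D₀, hD₀⟩ := h
    exact ⟨_, fun D hD ↦ by rw [MaslovCW.surfaceIntegral_trCurvature_eq hD hD₀]⟩
  · exact ⟨0, fun D hD ↦ (h ⟨D, hD⟩).elim⟩
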